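/- Let $n\in\mathbb{N}$, $n\ge 1$, let $\mathbb{K}\in\{\mathbb{R},\mathbb{C}\}$, let $1\le p,q\le\infty$ and $s\in(0,1)$. For $f\in L^1_{\mathrm{loc}}(\mathbb{R}^n;\mathbb{K})$ write $\Delta_hf(x)=f(x+h)-f(x)$ for $h\in\mathbb{R}^n$ and $\omega_p(t,f)=\sup_{|h|\le t}\|\Delta_hf\|_{L^p}$ for $t>0$, and define with values in $[0,\infty]$ $$[f]_{\tilde B^{s,p}_q}=\Big(\int_{B(0,1)}\big(|h|^{-s}\|\Delta_hf\|_{L^p}\big)^q|h|^{-n}\,dh\Big)^{1/q},\qquad [f]_{\dot B^{s,p}_q}=\Big(\int_0^\infty\big(t^{-s}\omega_p(t,f)\big)^q\,\frac{dt}{t}\Big)^{1/q}$$ if $q<\infty$, and, if $q=\infty$, $[f]_{\tilde B^{s,p}_\infty}=\operatorname{ess\,sup}_{h\in B(0,1)}|h|^{-s}\|\Delta_hf\|_{L^p}$ and $[f]_{\dot B^{s,p}_\infty}=\sup_{t>0}t^{-s}\omega_p(t,f)$. Put $\|f\|_{B^{s,p}_q}=\|f\|_{L^p}+[f]_{\dot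 B^{s,p}_q}$, and $[f]_{\dot W^{1,p}}=\sum_{j=1}^n\|\partial_jf\|_{L^p}$ with distributional derivatives (and $\|\partial_jf\|_{L^p}=\infty$ if $\partial_jf$ is not an $L^p$ function). The screened Besov space $\tilde B^{s,p}_q(\mathbb{R}^n;\mathbb{K})$, the inhomogeneous Besov space $B^{s,p}_q(\mathbb{R}^n;\mathbb{K})$ and the homogeneous Sobolev space $\dot W^{1,p}(\mathbb{R}^n;\mathbb{K})$ consist of all $f\in L^1_{\mathrm{loc}}(\mathbb{R}^n;\mathbb{K})$ for which $[f]_{\tilde B^{s,p}_q}$, $\|f\|_{B^{s,p}_q}$ and $[f]_{\dot W^{1,p}}$, respectively, are finite. Let $Q=(-1/2,1/2)^n$ and, for $f\in L^1_{\mathrm{loc}}(\mathbb{R}^n;\mathbb{K})$, $$\mathbb{L}f(x)=\int_Qf(x+y)\,dy,\qquad \mathbb{H}f(x)=\int_Q\big(f(x)-f(x+y)\big)\,dy .$$ Then there is a constant $c\in(0,\infty)$ such that for all $f\in L^1_{\mathrm{loc}}(\mathbb{R}^n;\mathbb{K})$, as an inequality in $[0,\infty]$, $$c^{-1}[f]_{\tilde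 B^{s,p}_q}\le\|\mathbb{H}f\|_{B^{s,p}_q}+[\mathbb{L}f]_{\dot W^{1,p}}\le c\,[f]_{\tilde B^{s,p}_q}.$$ Moreover, $\tilde B^{s,p}_q(\mathbb{R}^n;\mathbb{K})=B^{s,p}_q(\mathbb{R}^n;\mathbb{K})+\dot W^{1,p}(\mathbb{R}^n;\mathbb{K})$ as vector spaces, and the seminorm $[\cdot]_{\tilde B^{s,p}_q}$ is equivalent on this space to the sum seminorm $$[f]_\Sigma=\inf\big\{\|f_0\|_{B^{s,p}_q}+[f_1]_{\dot W^{1,p}}\;:\;f=f_0+f_1,\ f_0\in B^{s,p}_q(\mathbb{R}^n;\mathbb{K}),\ f_1\in\dot W^{1,p}(\mathbb{R}^n;\mathbb{K})\big\},$$ that is, there is $c'\in(0,\infty)$ with $(c')^{-1}[f]_{\tilde B^{s,p}_q}\le[f]_\Sigma\le c'[f]_{\tilde B^{s,p}_q}$ for all $f\in\tilde B^{s,p}_q(\mathbb{R}^n;\mathbb{K})$. -/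

import Mathlib

open MeasureTheory Set
open scoped ENNReal NNReal Pointwise

noncomputable section

namespace ScreenedBesov

/-- Forward difference `Δ_h f (x) = f (x + h) - f x`. -/
def fdiff {n : ℕ} {𝕜 : Type*} [RCLike 𝕜] (h : EuclideanSpace ℝ (Fin n))
    (f : EuclideanSpace ℝ (Fin n) → 𝕜) : EuclideanSpace ℝ (Fin n) → 𝕜 :=
  fun x => f (x + h) - f x

/-- The `L^p` modulus of continuity `ω_p(t, f) = sup_{|h| ≤ t} ‖Δ_h f‖_{L^p}`. -/
def modulus {n : ℕ} {𝕜 : Type*} [RCLike 𝕜] (p : ℝ≥0∞) (t : ℝ)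
    (f : EuclideanSpace ℝ (Fin n) → 𝕜) : ℝ≥0∞ :=
  ⨆ h ∈ Metric.closedBall (0 : EuclideanSpace ℝ (Fin n)) t, eLpNorm (fdiff h f) p volume

/-- The extended seminorm of the screened Besov space (screening radius `1`). -/
def screenedSeminorm {n : ℕ} {𝕜 : Type*} [RCLike 𝕜] (s : ℝ) (p q : ℝ≥0∞)
    (f : EuclideanSpace ℝ (Fin n) → 𝕜) : ℝ≥0∞ :=
  if q = ⊤ then
    essSup (fun h => ENNReal.ofReal (‖h‖ ^ (-s)) * eLpNorm (fdiff h f) p volume)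
      (volume.restrict (Metric.ball (0 : EuclideanSpace ℝ (Fin n)) 1))
  else
    (∫⁻ h in Metric.ball (0 : EuclideanSpace ℝ (Fin n)) 1,
      (ENNReal.ofReal (‖h‖ ^ (-s)) * eLpNorm (fdiff h f) p volume) ^ q.toReal *
        ENNReal.ofReal (‖h‖ ^ (-(n : ℝ)))) ^ (1 / q.toReal)

/-- The extended seminorm of the homogeneous Besov space. -/
def besovSeminorm {n : ℕ} {𝕜 : Type*} [RCLike 𝕜] (s : ℝ) (p q : ℝ≥0∞)
    (f : EuclideanSpace ℝ (Fin n) → 𝕜) : ℝ≥0∞ :=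
  if q = ⊤ then
    ⨆ t ∈ Ioi (0 : ℝ), ENNReal.ofReal (t ^ (-s)) * modulus p t f
  else
    (∫⁻ t in Ioi (0 : ℝ),
      (ENNReal.ofReal (t ^ (-s)) * modulus p t f) ^ q.toReal *
        ENNReal.ofReal t⁻¹) ^ (1 / q.toReal)

/-- The extended norm of the inhomogeneous Besov space `B^{s,p}_q = L^p ∩ Ḃ^{s,p}_q`. -/
def besovNorm {n : ℕ} {𝕜 : Type*} [RCLike 𝕜] (s : ℝ) (p q : ℝ≥0∞)
    (f : EuclideanSpace ℝ (Fin n) → 𝕜) : ℝ≥0∞ :=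
  eLpNorm f p volume + besovSeminorm s p q f

/-- The locally integrable function `g` is the `j`-th weak (distributional) partial derivative
of the locally integrable function `f`. -/
def IsWeakPartial {n : ℕ} {𝕜 : Type*} [RCLike 𝕜] (j : Fin n)
    (f g : EuclideanSpace ℝ (Fin n) → 𝕜) : Prop :=
  LocallyIntegrable f volume ∧ LocallyIntegrable g volume ∧
    ∀ φ : EuclideanSpace ℝ (Fin n) → ℝ, ContDiff ℝ (⊤ : ℕ∞) φ → HasCompactSupport φ →
      ∫ x, fderiv ℝ φ x (EuclideanSpace.single j 1) • f x = -∫ x, φ x • g x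

/-- The extended seminorm `∑_j ‖∂_j f‖_{L^p}` of the homogeneous Sobolev space. Weak derivatives
are unique up to null sets, so each infimum is `‖∂_j f‖_{L^p}` if `∂_j f` is a locally integrable
function, and `∞` otherwise. -/
def sobolevSeminorm {n : ℕ} {𝕜 : Type*} [RCLike 𝕜] (p : ℝ≥0∞)
    (f : EuclideanSpace ℝ (Fin n) → 𝕜) : ℝ≥0∞ :=
  ∑ j : Fin n, ⨅ (g : EuclideanSpace ℝ (Fin n) → 𝕜) (_ : IsWeakPartial j f g),
    eLpNorm g p volume

/-- The screened Besov space. -/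
def screenedSpace (n : ℕ) (𝕜 : Type*) [RCLike 𝕜] (s : ℝ) (p q : ℝ≥0∞) :
    Set (EuclideanSpace ℝ (Fin n) → 𝕜) :=
  {f | LocallyIntegrable f volume ∧ screenedSeminorm s p q f < ⊤}

/-- The inhomogeneous Besov space. -/
def besovSpace (n : ℕ) (𝕜 : Type*) [RCLike 𝕜] (s : ℝ) (p q : ℝ≥0∞) :
    Set (EuclideanSpace ℝ (Fin n) → 𝕜) :=
  {f | LocallyIntegrable f volume ∧ besovNorm s p q f < ⊤}

/-- The homogeneous Sobolev space: locally integrable functions all of whose weak first order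
partial derivatives are in `L^p`. -/
def sobolevSpace (n : ℕ) (𝕜 : Type*) [RCLike 𝕜] (p : ℝ≥0∞) :
    Set (EuclideanSpace ℝ (Fin n) → 𝕜) :=
  {f | LocallyIntegrable f volume ∧ ∀ j, ∃ g, IsWeakPartial j f g ∧ MemLp g p volume}

/-- The seminorm on the sum `X₀ + X₁` of two spaces with (extended) seminorms `N₀`, `N₁`:
the infimum of `N₀ x₀ + N₁ x₁` over all decompositions `x = x₀ + x₁`, `xᵢ ∈ Xᵢ`. -/
def sumSeminorm {V : Type*} [Add V] (X₀ X₁ : Set V) (N₀ N₁ : V → ℝ≥0∞) (x : V) : ℝ≥0∞ :=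
  ⨅ (x₀ ∈ X₀) (x₁ ∈ X₁) (_ : x = x₀ + x₁), N₀ x₀ + N₁ x₁

/-- The open unit cube centred at the origin. -/
def unitCube (n : ℕ) : Set (EuclideanSpace ℝ (Fin n)) :=
  {y | ∀ i, y i ∈ Ioo (-(1 / 2) : ℝ) (1 / 2)}

/-- The averaging operator `𝕃`. -/
def lowPart {n : ℕ} {𝕜 : Type*} [RCLike 𝕜] (f : EuclideanSpace ℝ (Fin n) → 𝕜) :
    EuclideanSpace ℝ (Fin n) → 𝕜 :=
  fun x => ∫ y in unitCube n, f (x + y)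

/-- The operator `ℍ`. -/
def highPart {n : ℕ} {𝕜 : Type*} [RCLike 𝕜] (f : EuclideanSpace ℝ (Fin n) → 𝕜) :
    EuclideanSpace ℝ (Fin n) → 𝕜 :=
  fun x => ∫ y in unitCube n, (f x - f (x + y))

end ScreenedBesov

end

noncomputable section

namespace ScreenedBesov

/-! ### Increments, the modulus of continuity and its domination by averages. -/

section Differences

variable {n : ℕ} {𝕜 : Type*} [RCLike 𝕜] {f g : EuclideanSpace ℝ (Fin n) → 𝕜}
  {h : EuclideanSpace ℝ (Fin n)} {p : ℝ≥0∞}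

/-! Everything rests on the size of increments `a h = ‖Δ_h f‖_{L^p}`, which is measurable, vanishes
at `0` and is subadditive. Splitting `h = (h/2 + k) + (h/2 - k)` and averaging over small `k` bounds
`ω_p(t, f)` by the mean of `a` over the ball of radius `t` (`modulus_mul_volume_ball_le`). With
Jensen and Tonelli, the screened seminorm therefore controls the Besov integral over scales `t ≤ 1`
(`exists_besovFunctional_le`), and also `ω_p(1, f)` (`exists_modulus_one_le`).

For the upper bound, `∂_j 𝕃 f` is an average of translates of `Δ_{e_j} f` (`isWeakPartial_lowPart`),
and `ℍ f` is an average of `-Δ_y f` over the cube. By Minkowski both are bounded in `L^p` by a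
multiple of `ω_p(1, f)`. Moreover `‖Δ_h ℍ f‖ ≤ 2 ‖Δ_h f‖` serves for `t ≤ 1` and `ω_p(t, ℍ f) ≤ 2 ‖ℍ
f‖` for `t > 1`.

For the lower bound, a Besov function satisfies `a h ≤ ω_p(‖h‖, f)`, and Tonelli compares the
integral over `h` with the one over `t` (`exists_screenedFunctional_norm_le`). A Sobolev function
satisfies `a h ≤ ‖h‖ [f]`, and `‖h‖` has a finite screened functional since `s < 1`.

Since `f = ℍ f + 𝕃 f`, these two bounds also give the sum of spaces and the equivalence with the sum
seminorm. -/

theorem fdiff_congr_ae (hfg : f =ᵐ[volume] g) (h : EuclideanSpace ℝ (Fin n)) :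
    fdiff h f =ᵐ[volume] fdiff h g := by
  have h1 := (measurePreserving_add_right volume h).quasiMeasurePreserving.ae_eq_comp hfg
  filter_upwards [hfg, h1] with x hx hx'
  simp only [Function.comp] at hx'
  simp [fdiff, hx, hx']

theorem eLpNorm_fdiff_congr_ae (hfg : f =ᵐ[volume] g) (p : ℝ≥0∞)
    (h : EuclideanSpace ℝ (Fin n)) :
    eLpNorm (fdiff h f) p volume = eLpNorm (fdiff h g) p volume :=
  eLpNorm_congr_ae (fdiff_congr_ae hfg h)

theorem aestronglyMeasurable_comp_add (hf : AEStronglyMeasurable f volume)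
    (h : EuclideanSpace ℝ (Fin n)) : AEStronglyMeasurable (fun x => f (x + h)) volume :=
  hf.comp_measurePreserving (measurePreserving_add_right volume h)

theorem aestronglyMeasurable_fdiff (hf : AEStronglyMeasurable f volume)
    (h : EuclideanSpace ℝ (Fin n)) : AEStronglyMeasurable (fdiff h f) volume :=
  (aestronglyMeasurable_comp_add hf h).sub hf

theorem eLpNorm_comp_add (hf : AEStronglyMeasurable f volume) (p : ℝ≥0∞)
    (h : EuclideanSpace ℝ (Fin n)) :
    eLpNorm (fun x => f (x + h)) p volume = eLpNorm f p volume :=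
  eLpNorm_comp_measurePreserving hf (measurePreserving_add_right volume h)

theorem fdiff_add_apply (f g : EuclideanSpace ℝ (Fin n) → 𝕜) :
    fdiff h (f + g) = fdiff h f + fdiff h g := by
  ext x; simp [fdiff]; ring

theorem eLpNorm_fdiff_add_fun_le (hf : AEStronglyMeasurable f volume)
    (hg : AEStronglyMeasurable g volume) (hp : 1 ≤ p) (h : EuclideanSpace ℝ (Fin n)) :
    eLpNorm (fdiff h (f + g)) p volume ≤
      eLpNorm (fdiff h f) p volume + eLpNorm (fdiff h g) p volume := by
  rw [fdiff_add_apply]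
  exact eLpNorm_add_le (aestronglyMeasurable_fdiff hf h) (aestronglyMeasurable_fdiff hg h) hp

theorem eLpNorm_fdiff_le (hf : AEStronglyMeasurable f volume) (hp : 1 ≤ p)
    (h : EuclideanSpace ℝ (Fin n)) :
    eLpNorm (fdiff h f) p volume ≤ 2 * eLpNorm f p volume := by
  refine (eLpNorm_sub_le (aestronglyMeasurable_comp_add hf h) hf hp).trans ?_
  rw [eLpNorm_comp_add hf, two_mul]

theorem eLpNorm_fdiff_zero : eLpNorm (fdiff 0 f) p volume = 0 := by
  have : fdiff 0 f = 0 := by ext x; simp [fdiff]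
  simp [this]

/-- By `Δ_{h+k} f = Δ_h f + (Δ_k f)(· + h)` and translation invariance of the norm. -/
theorem eLpNorm_fdiff_add_le (hf : AEStronglyMeasurable f volume) (hp : 1 ≤ p)
    (h k : EuclideanSpace ℝ (Fin n)) :
    eLpNorm (fdiff (h + k) f) p volume ≤
      eLpNorm (fdiff h f) p volume + eLpNorm (fdiff k f) p volume := by
  have h1 : fdiff (h + k) f = fdiff h f + fun x => fdiff k f (x + h) := by
    ext x
    simp only [fdiff, Pi.add_apply, add_assoc]
    ring
  rw [h1, ← eLpNorm_comp_add (aestronglyMeasurable_fdiff hf k) p h]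
  exact eLpNorm_add_le (aestronglyMeasurable_fdiff hf h)
    (aestronglyMeasurable_comp_add (aestronglyMeasurable_fdiff hf k) h) hp

theorem eLpNorm_fdiff_sum_le (hf : AEStronglyMeasurable f volume) (hp : 1 ≤ p) {ι : Type*}
    (t : Finset ι) (v : ι → EuclideanSpace ℝ (Fin n)) :
    eLpNorm (fdiff (∑ i ∈ t, v i) f) p volume ≤ ∑ i ∈ t, eLpNorm (fdiff (v i) f) p volume := by
  classical
  induction t using Finset.induction_on with
  | empty => simp [eLpNorm_fdiff_zero]
  | insert i t hi ih =>
    rw [Finset.sum_insert hi, Finset.sum_insert hi]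
    exact (eLpNorm_fdiff_add_le hf hp _ _).trans (by gcongr)

theorem eLpNorm_fdiff_nsmul_le (hf : AEStronglyMeasurable f volume) (hp : 1 ≤ p) (m : ℕ)
    (h : EuclideanSpace ℝ (Fin n)) :
    eLpNorm (fdiff (m • h) f) p volume ≤ m * eLpNorm (fdiff h f) p volume := by
  simpa using eLpNorm_fdiff_sum_le hf hp (Finset.range m) (fun _ => h)

theorem eLpNorm_fdiff_le_modulus {t : ℝ} (ht : ‖h‖ ≤ t) :
    eLpNorm (fdiff h f) p volume ≤ modulus p t f :=
  le_iSup₂_of_le h (by simpa using ht) le_rfl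

theorem modulus_mono : Monotone fun t => modulus p t f := fun _ _ hst =>
  biSup_mono fun _ hh => Metric.closedBall_subset_closedBall hst hh

/-- The `L^p` norms of the sections of a jointly measurable function depend measurably on the
parameter. -/
theorem measurable_eLpNorm_section {X Y G : Type*} [MeasurableSpace X] [MeasurableSpace Y]
    [NormedAddCommGroup G] {μ : Measure X} [SFinite μ] {F : Y → X → G}
    (hF : StronglyMeasurable (Function.uncurry F)) (p : ℝ≥0∞) :
    Measurable fun y => eLpNorm (F y) p μ := by
  rcases eq_or_ne p 0 with rfl | hp0
  · simp
  rcases eq_or_ne p ⊤ with rfl | hp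
  · refine measurable_of_Iic fun c => ?_
    -- An essential supremum is at most `c` exactly when the section of `{c < ‖F‖ₑ}` is null, and
    -- measures of sections are measurable.
    have h1 : (fun y => eLpNorm (F y) ⊤ μ) ⁻¹' Iic c =
        {y | μ (Prod.mk y ⁻¹' {z : Y × X | c < ‖F z.1 z.2‖ₑ}) = 0} := by
      ext y
      simp only [mem_preimage, mem_Iic, eLpNorm_exponent_top, eLpNormEssSup, mem_ofPred_eq]
      have : μ (Prod.mk y ⁻¹' {z : Y × X | c < ‖F z.1 z.2‖ₑ}) = 0 ↔
          ∀ᵐ x ∂μ, ‖F y x‖ₑ ≤ c := by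
        simp [ae_iff, preimage]
      rw [this]
      exact ⟨fun h => (ENNReal.ae_le_essSup _).mono fun x hx => hx.trans h,
        fun h => essSup_le_of_ae_le _ h⟩
    rw [h1]
    have h2 : MeasurableSet {z : Y × X | c < ‖F z.1 z.2‖ₑ} :=
      measurableSet_lt measurable_const hF.enorm
    exact measurable_measure_prodMk_left h2 (measurableSet_singleton 0)
  · simp only [eLpNorm_eq_lintegral_rpow_enorm_toReal hp0 hp]
    refine Measurable.pow_const ?_ _
    have : Measurable fun z : Y × X => ‖F z.1 z.2‖ₑ ^ p.toReal := hF.enorm.pow_const _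
    exact this.lintegral_prod_right'

theorem measurable_eLpNorm_fdiff (hf : AEStronglyMeasurable f volume) (p : ℝ≥0∞) :
    Measurable fun h => eLpNorm (fdiff h f) p volume := by
  have h1 : (fun h => eLpNorm (fdiff h f) p volume) =
      fun h => eLpNorm (fdiff h (hf.mk f)) p volume :=
    funext fun h => eLpNorm_fdiff_congr_ae hf.ae_eq_mk p h
  rw [h1]
  refine measurable_eLpNorm_section (F := fun h => fdiff h (hf.mk f)) ?_ p
  exact (hf.stronglyMeasurable_mk.comp_measurable (measurable_snd.add measurable_fst)).sub
    (hf.stronglyMeasurable_mk.comp_measurable measurable_snd)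

/-- The increments in a ball dominate the modulus of continuity on average. -/
theorem modulus_mul_volume_ball_le (hf : AEStronglyMeasurable f volume) (hp : 1 ≤ p) {t : ℝ} :
    modulus p t f * volume (Metric.ball (0 : EuclideanSpace ℝ (Fin n)) (t / 2)) ≤
      2 * ∫⁻ k in Metric.ball (0 : EuclideanSpace ℝ (Fin n)) t,
        eLpNorm (fdiff k f) p volume := by
  simp only [modulus, ENNReal.iSup_mul, iSup_le_iff]
  intro h hh
  set a : EuclideanSpace ℝ (Fin n) → ℝ≥0∞ := fun k => eLpNorm (fdiff k f) p volume with ha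
  have ham : Measurable a := measurable_eLpNorm_fdiff hf p
  set B := Metric.ball (0 : EuclideanSpace ℝ (Fin n)) (t / 2)
  have hh' : ‖h‖ ≤ t := by simpa using hh
  -- Used for `k ↦ h/2 ± k`: both map the ball of radius `t/2` into that of radius `t`, and the two
  -- images add up to `h`.
  have key (T : EuclideanSpace ℝ (Fin n) → EuclideanSpace ℝ (Fin n))
      (hT : MeasurePreserving T volume volume) (hTe : MeasurableEmbedding T)
      (hTB : B ⊆ T ⁻¹' (Metric.ball 0 t)) :
      ∫⁻ k in B, a (T k) ≤ ∫⁻ k in Metric.ball (0 : EuclideanSpace ℝ (Fin n)) t, a k := by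
    rw [← hT.setLIntegral_comp_preimage_emb hTe a (Metric.ball 0 t)]
    exact lintegral_mono_set hTB
  have hn : ‖(1 / 2 : ℝ) • h‖ ≤ t / 2 := by
    rw [norm_smul]; norm_num; linarith
  have k1 := key (fun k => (1 / 2 : ℝ) • h + k) (measurePreserving_add_left volume _)
    (measurableEmbedding_addLeft _) (fun k hk => by
      have hk : ‖k‖ < t / 2 := by simpa [B] using hk
      have : ‖(1 / 2 : ℝ) • h + k‖ < t := (norm_add_le _ _).trans_lt (by linarith)
      rwa [mem_preimage, mem_ball_zero_iff])
  have k2 := key (fun k => (1 / 2 : ℝ) • h - k) (Measure.measurePreserving_sub_left volume _)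
    (measurableEmbedding_subLeft _) (fun k hk => by
      have hk : ‖k‖ < t / 2 := by simpa [B] using hk
      have : ‖(1 / 2 : ℝ) • h - k‖ < t := (norm_sub_le _ _).trans_lt (by linarith)
      rwa [mem_preimage, mem_ball_zero_iff])
  calc a h * volume B = ∫⁻ k in B, a h := by simp
    _ ≤ ∫⁻ k in B, (a ((1 / 2 : ℝ) • h + k) + a ((1 / 2 : ℝ) • h - k)) := by
        refine lintegral_mono fun k => ?_
        have := eLpNorm_fdiff_add_le hf hp ((1 / 2 : ℝ) • h + k) ((1 / 2 : ℝ) • h - k)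
        have e : ((1 / 2 : ℝ) • h + k) + ((1 / 2 : ℝ) • h - k) = h := by
          rw [add_add_sub_cancel, ← add_smul]; norm_num
        rwa [e] at this
    _ = (∫⁻ k in B, a ((1 / 2 : ℝ) • h + k)) + ∫⁻ k in B, a ((1 / 2 : ℝ) • h - k) :=
        lintegral_add_left (ham.comp (measurable_const_add _)) _
    _ ≤ _ := by rw [two_mul]; exact add_le_add k1 k2

end Differences

/-! ### Weighted `L^q` functionals: Minkowski, finiteness for `‖h‖`, and the bound by the Besov
functional. -/

section Functionals

/-- The weighted `L^q` functional underlying the screened Besov seminorm. -/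
def screenedFunctional {n : ℕ} (s : ℝ) (q : ℝ≥0∞) (a : EuclideanSpace ℝ (Fin n) → ℝ≥0∞) : ℝ≥0∞ :=
  if q = ⊤ then
    essSup (fun h => ENNReal.ofReal (‖h‖ ^ (-s)) * a h)
      (volume.restrict (Metric.ball (0 : EuclideanSpace ℝ (Fin n)) 1))
  else
    (∫⁻ h in Metric.ball (0 : EuclideanSpace ℝ (Fin n)) 1,
      (ENNReal.ofReal (‖h‖ ^ (-s)) * a h) ^ q.toReal *
        ENNReal.ofReal (‖h‖ ^ (-(n : ℝ)))) ^ (1 / q.toReal)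

/-- The weighted `L^q` functional underlying the homogeneous Besov seminorm. -/
def besovFunctional (s : ℝ) (q : ℝ≥0∞) (w : ℝ → ℝ≥0∞) : ℝ≥0∞ :=
  if q = ⊤ then
    ⨆ t ∈ Ioi (0 : ℝ), ENNReal.ofReal (t ^ (-s)) * w t
  else
    (∫⁻ t in Ioi (0 : ℝ),
      (ENNReal.ofReal (t ^ (-s)) * w t) ^ q.toReal * ENNReal.ofReal t⁻¹) ^ (1 / q.toReal)

variable {n : ℕ} {s : ℝ} {q : ℝ≥0∞} {a b : EuclideanSpace ℝ (Fin n) → ℝ≥0∞} {w : ℝ → ℝ≥0∞}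

theorem ofReal_rpow_neg_mul_rpow {r : ℝ} (hr : 0 ≤ r) (s : ℝ) {Q : ℝ} (hQ : 0 ≤ Q) (x : ℝ≥0∞) :
    (ENNReal.ofReal (r ^ (-s)) * x) ^ Q = ENNReal.ofReal (r ^ (-(s * Q))) * x ^ Q := by
  rw [ENNReal.mul_rpow_of_nonneg _ _ hQ, ENNReal.ofReal_rpow_of_nonneg (Real.rpow_nonneg hr _) hQ,
    ← Real.rpow_mul hr, neg_mul]

theorem screenedFunctional_of_ne_top (hs : 0 < s) (hq : 1 ≤ q) (hq' : q ≠ ⊤)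
    (a : EuclideanSpace ℝ (Fin n) → ℝ≥0∞) :
    screenedFunctional s q a =
      (∫⁻ h in Metric.ball (0 : EuclideanSpace ℝ (Fin n)) 1,
        ENNReal.ofReal (‖h‖ ^ (-(s * q.toReal + n))) * a h ^ q.toReal) ^ (1 / q.toReal) := by
  have hQ : 0 < q.toReal := ENNReal.toReal_pos (by positivity) hq'
  rw [screenedFunctional, if_neg hq']
  congr 1
  refine lintegral_congr fun h => ?_
  -- Multiplying the weights at `‖h‖ = 0` is legitimate only for a nonzero total exponent; `s > 0`
  -- ensures this even when `n = 0`.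
  have h1 : (-(s * q.toReal + n)) ≠ 0 := by
    have : 0 < s * q.toReal + n := by positivity
    linarith
  rw [ofReal_rpow_neg_mul_rpow (norm_nonneg h) s hQ.le, mul_right_comm,
    ← ENNReal.ofReal_mul (by positivity), ← Real.rpow_add' (norm_nonneg h) (by convert h1 using 1; ring)]
  congr 4
  ring

theorem besovFunctional_of_ne_top (hq' : q ≠ ⊤) (w : ℝ → ℝ≥0∞) :
    besovFunctional s q w =
      (∫⁻ t in Ioi (0 : ℝ), ENNReal.ofReal (t ^ (-(s * q.toReal) - 1)) * w t ^ q.toReal) ^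
        (1 / q.toReal) := by
  rw [besovFunctional, if_neg hq']
  congr 1
  refine setLIntegral_congr_fun measurableSet_Ioi fun t ht => ?_
  have ht : 0 < t := ht
  rw [ofReal_rpow_neg_mul_rpow ht.le s ENNReal.toReal_nonneg, mul_right_comm,
    ← ENNReal.ofReal_mul (by positivity), ← Real.rpow_neg_one, ← Real.rpow_add ht]
  rfl

theorem screenedFunctional_mono (hab : ∀ h, a h ≤ b h) :
    screenedFunctional s q a ≤ screenedFunctional s q b := by
  unfold screenedFunctional
  split_ifs
  · exact essSup_mono_ae (.of_forall fun h => mul_le_mul_right (hab h) _)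
  · gcongr with h
    exact hab h

theorem screenedFunctional_add_le (hs : 0 < s) (hq : 1 ≤ q) (ha : Measurable a)
    (hb : Measurable b) :
    screenedFunctional s q (fun h => a h + b h) ≤
      screenedFunctional s q a + screenedFunctional s q b := by
  rcases eq_or_ne q ⊤ with rfl | hq'
  · simp only [screenedFunctional, if_true, mul_add]
    exact ENNReal.essSup_add_le _ _
  have hQ : 1 ≤ q.toReal := by
    rw [← ENNReal.toReal_one]; exact ENNReal.toReal_mono hq' hq
  have hQ0 : 0 < q.toReal := by linarith
  -- The `Q`-th root of the weight is absorbed into the function, so that Minkowski's inequality for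
  -- Lebesgue measure applies.
  set W : EuclideanSpace ℝ (Fin n) → ℝ≥0∞ := fun h =>
    ENNReal.ofReal (‖h‖ ^ (-(s * q.toReal + n))) ^ (1 / q.toReal) with hW
  have hWm : Measurable W := by fun_prop
  have key (c : EuclideanSpace ℝ (Fin n) → ℝ≥0∞) (h : EuclideanSpace ℝ (Fin n)) :
      ENNReal.ofReal (‖h‖ ^ (-(s * q.toReal + n))) * c h ^ q.toReal =
        (W h * c h) ^ q.toReal := by
    rw [ENNReal.mul_rpow_of_nonneg _ _ hQ0.le, hW]
    simp only
    rw [← ENNReal.rpow_mul, one_div_mul_cancel hQ0.ne', ENNReal.rpow_one]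
  simp only [screenedFunctional_of_ne_top hs hq hq']
  rw [lintegral_congr (key _), lintegral_congr (key a), lintegral_congr (key b)]
  simp only [mul_add]
  exact ENNReal.lintegral_Lp_add_le (hWm.mul ha).aemeasurable (hWm.mul hb).aemeasurable hQ

theorem screenedFunctional_const_mul (hs : 0 < s) (hq : 1 ≤ q) {c : ℝ≥0∞} (hc : c ≠ ⊤) :
    screenedFunctional s q (fun h => c * a h) = c * screenedFunctional s q a := by
  rcases eq_or_ne q ⊤ with rfl | hq'
  · simp only [screenedFunctional, if_true, mul_left_comm _ c]
    exact ENNReal.essSup_const_mul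
  have hQ0 : 0 < q.toReal := ENNReal.toReal_pos (by positivity) hq'
  simp only [screenedFunctional_of_ne_top hs hq hq']
  simp only [ENNReal.mul_rpow_of_nonneg _ _ hQ0.le, mul_left_comm _ (c ^ q.toReal)]
  rw [lintegral_const_mul' _ _ (ENNReal.rpow_ne_top_of_nonneg hQ0.le hc),
    ENNReal.mul_rpow_of_nonneg _ _ (by positivity), ← ENNReal.rpow_mul, mul_one_div_cancel hQ0.ne',
    ENNReal.rpow_one]

/-- Here `s < 1` enters: for `q < ∞` the integrand is `‖h‖ ^ ((1 - s) q - n)`, whose exponent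
exceeds `-n`. -/
theorem screenedFunctional_norm_lt_top (hn : 0 < n) (hs : s ∈ Ioo (0 : ℝ) 1) (hq : 1 ≤ q) :
    screenedFunctional s q (fun h : EuclideanSpace ℝ (Fin n) => ENNReal.ofReal ‖h‖) < ⊤ := by
  rcases eq_or_ne q ⊤ with rfl | hq'
  · rw [screenedFunctional, if_pos rfl]
    refine lt_of_le_of_lt (essSup_le_of_ae_le 1 ?_) ENNReal.one_lt_top
    filter_upwards [ae_restrict_mem Metric.isOpen_ball.measurableSet] with h hh
    have hh : ‖h‖ < 1 := by simpa using hh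
    rw [← ENNReal.ofReal_mul (by positivity)]
    refine ENNReal.ofReal_le_of_le_toReal ?_
    rw [ENNReal.toReal_one]
    rcases eq_or_ne ‖h‖ 0 with h0 | h0
    · simp [h0]
    · rw [← Real.rpow_add_one h0]
      exact Real.rpow_le_one (norm_nonneg h) hh.le (by linarith [hs.2])
  have hQ0 : 0 < q.toReal := ENNReal.toReal_pos (by positivity) hq'
  rw [screenedFunctional_of_ne_top hs.1 hq hq']
  refine ENNReal.rpow_lt_top_of_nonneg (by positivity) (ne_of_lt ?_)
  have h1 : LocallyIntegrable (fun h : EuclideanSpace ℝ (Fin n) =>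
      ‖h‖ ^ (-((n : ℝ) - (1 - s) * q.toReal))) volume := by
    refine locallyIntegrable_of_norm_le_rpow (C := 1) (α := (n : ℝ) - (1 - s) * q.toReal) ?_ ?_ ?_ ?_
    · simpa using Nat.one_le_iff_ne_zero.2 hn.ne'
    · have : 0 < (1 - s) * q.toReal := mul_pos (by linarith [hs.2]) hQ0
      simpa using this
    · refine .of_forall fun x => ?_
      rw [Real.norm_of_nonneg (by positivity), one_mul]
    · exact (measurable_norm.pow_const _).aestronglyMeasurable
  have h2 := (h1.integrableOn_isCompact
    (isCompact_closedBall (0 : EuclideanSpace ℝ (Fin n)) 1)).mono_set Metric.ball_subset_closedBall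
  refine lt_of_le_of_lt (lintegral_mono fun h => ?_) h2.2
  rw [ENNReal.ofReal_rpow_of_nonneg (norm_nonneg h) hQ0.le, ← ENNReal.ofReal_mul (by positivity),
    ← ofReal_norm, Real.norm_of_nonneg (by positivity)]
  refine ENNReal.ofReal_le_ofReal ?_
  rcases eq_or_ne ‖h‖ 0 with h0 | h0
  · rw [h0, Real.zero_rpow hQ0.ne', mul_zero]
    exact Real.rpow_nonneg (norm_nonneg h) _
  · rw [← Real.rpow_add (by positivity)]
    refine le_of_eq ?_
    congr 1
    ring

theorem lintegral_Ioi_rpow {α r : ℝ} (hα : 0 < α) (hr : 0 < r) :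
    ∫⁻ t in Ioi r, ENNReal.ofReal (t ^ (-α - 1)) = ENNReal.ofReal (r ^ (-α) / α) := by
  rw [← ofReal_integral_eq_lintegral_ofReal (integrableOn_Ioi_rpow_of_lt (by linarith) hr),
    integral_Ioi_rpow_of_lt (by linarith) hr]
  · congr 1
    rw [sub_add_cancel, neg_div_neg_eq]
  · filter_upwards [ae_restrict_mem measurableSet_Ioi] with t ht
    have : 0 < t := hr.trans ht
    positivity

theorem volume_ball_eq {t : ℝ} (ht : 0 < t) :
    volume (Metric.ball (0 : EuclideanSpace ℝ (Fin n)) t) =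
      ENNReal.ofReal (t ^ n) * volume (Metric.ball (0 : EuclideanSpace ℝ (Fin n)) 1) := by
  simpa using Measure.addHaar_ball_of_pos volume (0 : EuclideanSpace ℝ (Fin n)) ht

theorem measurableSet_norm_lt : MeasurableSet
    {z : EuclideanSpace ℝ (Fin n) × ℝ | ‖z.1‖ < z.2} :=
  measurableSet_lt (measurable_fst.norm) measurable_snd

/-- Only `(r, 2r]` is kept: there `w t ≥ w r` and `t ^ (-β - 1) ≥ (2r) ^ (-β - 1)`, and the interval
has length `r`. -/
theorem rpow_le_two_rpow_mul_lintegral {Q β r : ℝ} (hQ : 0 ≤ Q) (hβ : 0 < β) (hr : 0 < r)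
    (hw : Monotone w) :
    ENNReal.ofReal (r ^ (-β)) * w r ^ Q ≤
      ENNReal.ofReal (2 ^ (β + 1)) * ∫⁻ t in Ioi r, ENNReal.ofReal (t ^ (-β - 1)) * w t ^ Q := by
  have h1 : ENNReal.ofReal ((2 * r) ^ (-β - 1)) * w r ^ Q * ENNReal.ofReal r ≤
      ∫⁻ t in Ioi r, ENNReal.ofReal (t ^ (-β - 1)) * w t ^ Q := by
    calc ENNReal.ofReal ((2 * r) ^ (-β - 1)) * w r ^ Q * ENNReal.ofReal r
        = ∫⁻ _ in Ioc r (2 * r), ENNReal.ofReal ((2 * r) ^ (-β - 1)) * w r ^ Q := by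
          rw [setLIntegral_const, Real.volume_Ioc]
          congr 2
          ring
      _ ≤ ∫⁻ t in Ioc r (2 * r), ENNReal.ofReal (t ^ (-β - 1)) * w t ^ Q := by
          refine setLIntegral_mono' measurableSet_Ioc fun t ht => ?_
          refine mul_le_mul' (ENNReal.ofReal_le_ofReal ?_) (ENNReal.rpow_le_rpow (hw ht.1.le) hQ)
          exact Real.rpow_le_rpow_of_nonpos (hr.trans ht.1) ht.2 (by linarith)
      _ ≤ _ := lintegral_mono_set Ioc_subset_Ioi_self
  refine le_trans (le_of_eq ?_) (mul_le_mul_right h1 _)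
  rw [mul_right_comm _ (w r ^ Q), ← mul_assoc, ← ENNReal.ofReal_mul (by positivity),
    ← ENNReal.ofReal_mul (by positivity)]
  congr 2
  rw [Real.mul_rpow (by positivity) hr.le, mul_assoc, ← Real.rpow_add_one hr.ne', sub_add_cancel,
    ← mul_assoc, ← Real.rpow_add (by positivity)]
  have : β + 1 + (-β - 1) = 0 := by ring
  rw [this, Real.rpow_zero, one_mul]

/-- Tonelli on `{‖h‖ < t}` replaces polar coordinates, after the value at `‖h‖` has been bounded by
an integral over `t > ‖h‖`. -/
theorem exists_screenedFunctional_norm_le (n : ℕ) (hs : 0 < s) (hq : 1 ≤ q) :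
    ∃ C : ℝ≥0, ∀ w : ℝ → ℝ≥0∞, Monotone w →
      screenedFunctional s q (fun h : EuclideanSpace ℝ (Fin n) => w ‖h‖) ≤
        C * besovFunctional s q w := by
  rcases eq_or_ne q ⊤ with rfl | hq'
  · refine ⟨1, fun w _ => ?_⟩
    simp only [screenedFunctional, besovFunctional, if_true]
    refine essSup_le_of_ae_le _ (.of_forall fun h => ?_)
    -- The real power `0 ^ (-s)` is `0`, so the origin contributes nothing.
    rcases eq_or_ne ‖h‖ 0 with h0 | h0
    · simp [h0, Real.zero_rpow (neg_ne_zero.2 hs.ne')]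
    · rw [ENNReal.coe_one, one_mul]
      exact le_iSup₂_of_le ‖h‖ (by simpa using h0) le_rfl
  have hQ0 : 0 < q.toReal := ENNReal.toReal_pos (by positivity) hq'
  set Q := q.toReal
  set β := s * Q + n with hβdef
  have hβ : 0 < β := by positivity
  set V := volume (Metric.ball (0 : EuclideanSpace ℝ (Fin n)) 1)
  have hV : V ≠ ⊤ := measure_ball_lt_top.ne
  have hC : (ENNReal.ofReal (2 ^ (β + 1)) * V) ^ (1 / Q) ≠ ⊤ :=
    ENNReal.rpow_ne_top_of_nonneg (by positivity) (ENNReal.mul_ne_top ENNReal.ofReal_ne_top hV)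
  refine ⟨((ENNReal.ofReal (2 ^ (β + 1)) * V) ^ (1 / Q)).toNNReal, fun w hw => ?_⟩
  rw [ENNReal.coe_toNNReal hC, screenedFunctional_of_ne_top hs hq hq',
    besovFunctional_of_ne_top hq', ← ENNReal.mul_rpow_of_nonneg _ _ (by positivity)]
  refine ENNReal.rpow_le_rpow ?_ (by positivity)
  set F : ℝ → ℝ≥0∞ := fun t => ENNReal.ofReal (t ^ (-β - 1)) * w t ^ Q
  have hwm : Measurable w := hw.measurable
  have hF : Measurable F := by fun_prop
  set G : EuclideanSpace ℝ (Fin n) → ℝ → ℝ≥0∞ := fun h t => (Ioi ‖h‖).indicator F t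
  have hG : Measurable (Function.uncurry G) := by
    have : Function.uncurry G = {z : EuclideanSpace ℝ (Fin n) × ℝ | ‖z.1‖ < z.2}.indicator
        (fun z => F z.2) := by
      ext z
      simp [G, Function.uncurry, indicator]
    rw [this]
    exact (hF.comp measurable_snd).indicator measurableSet_norm_lt
  calc ∫⁻ h in Metric.ball (0 : EuclideanSpace ℝ (Fin n)) 1,
        ENNReal.ofReal (‖h‖ ^ (-β)) * w ‖h‖ ^ Q
      ≤ ∫⁻ h : EuclideanSpace ℝ (Fin n), ENNReal.ofReal (‖h‖ ^ (-β)) * w ‖h‖ ^ Q :=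
        setLIntegral_le_lintegral _ _
    _ ≤ ∫⁻ h : EuclideanSpace ℝ (Fin n), ENNReal.ofReal (2 ^ (β + 1)) *
          ∫⁻ t in Ioi (0 : ℝ), G h t := by
        refine lintegral_mono fun h => ?_
        rcases eq_or_ne ‖h‖ 0 with h0 | h0
        · simp [h0, Real.zero_rpow (neg_ne_zero.2 hβ.ne')]
        · refine (rpow_le_two_rpow_mul_lintegral hQ0.le hβ (by positivity) hw).trans ?_
          refine mul_le_mul_right (le_of_eq ?_) _
          rw [setLIntegral_indicator measurableSet_Ioi, Ioi_inter_Ioi,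
            sup_eq_left.2 (norm_nonneg h)]
    _ = ENNReal.ofReal (2 ^ (β + 1)) * ∫⁻ t in Ioi (0 : ℝ), ∫⁻ h, G h t := by
        rw [lintegral_const_mul' _ _ ENNReal.ofReal_ne_top,
          lintegral_lintegral_swap hG.aemeasurable]
    _ = ENNReal.ofReal (2 ^ (β + 1)) *
          ∫⁻ t in Ioi (0 : ℝ), V * (ENNReal.ofReal (t ^ (-(s * Q) - 1)) * w t ^ Q) := by
        congr 1
        refine setLIntegral_congr_fun measurableSet_Ioi fun t ht => ?_
        have ht : 0 < t := ht
        -- The section in `h` is a ball of volume `t ^ n * V`, which lowers the exponent from `β =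
        -- sQ + n` to `sQ`.
        have : (fun h => G h t) = (Metric.ball (0 : EuclideanSpace ℝ (Fin n)) t).indicator
            (fun _ => F t) := by
          ext h
          simp [G, indicator]
        rw [this, lintegral_indicator_const Metric.isOpen_ball.measurableSet, volume_ball_eq ht]
        simp only [F]
        rw [mul_comm, mul_right_comm, mul_comm _ V, ← mul_assoc (ENNReal.ofReal (t ^ n)),
          ← ENNReal.ofReal_mul (by positivity), ← Real.rpow_natCast, ← Real.rpow_add ht]
        congr 4
        rw [hβdef]
        ring
    _ = _ := by
        rw [lintegral_const_mul' _ _ hV, mul_assoc]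

end Functionals

/-! ### From averages over balls to the Besov functional. -/

section Functionals

variable {n : ℕ} {s : ℝ} {q : ℝ≥0∞} {a : EuclideanSpace ℝ (Fin n) → ℝ≥0∞} {w : ℝ → ℝ≥0∞}

/-- Jensen's inequality for powers of lower integrals. -/
theorem lintegral_rpow_le_measure_rpow_mul {X : Type*} [MeasurableSpace X] {μ : Measure X}
    {u : X → ℝ≥0∞} (hu : AEMeasurable u μ) {Q : ℝ} (hQ : 1 ≤ Q) :
    (∫⁻ x, u x ∂μ) ^ Q ≤ μ univ ^ (Q - 1) * ∫⁻ x, u x ^ Q ∂μ := by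
  have hQ0 : 0 < Q := by linarith
  have h := eLpNorm'_le_eLpNorm'_mul_rpow_measure_univ (f := u) (μ := μ) one_pos hQ
    hu.aestronglyMeasurable
  simp only [eLpNorm', enorm_eq_self, ENNReal.rpow_one, div_one] at h
  refine (ENNReal.rpow_le_rpow h hQ0.le).trans (le_of_eq ?_)
  rw [ENNReal.mul_rpow_of_nonneg _ _ hQ0.le, ← ENNReal.rpow_mul, ← ENNReal.rpow_mul,
    one_div_mul_cancel hQ0.ne', ENNReal.rpow_one, mul_comm, sub_mul, one_mul,
    one_div_mul_cancel hQ0.ne']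

/-- The assumption at the origin matters: the weight may be `0` there, and for `n = 0` the origin is
not a null set. -/
theorem ae_le_screenedFunctional_top (h0 : a 0 = 0) :
    ∀ᵐ h ∂(volume.restrict (Metric.ball (0 : EuclideanSpace ℝ (Fin n)) 1)),
      a h ≤ ENNReal.ofReal (‖h‖ ^ s) * screenedFunctional s ⊤ a := by
  have h1 := ENNReal.ae_le_essSup (μ := volume.restrict
    (Metric.ball (0 : EuclideanSpace ℝ (Fin n)) 1)) (fun h => ENNReal.ofReal (‖h‖ ^ (-s)) * a h)
  filter_upwards [h1] with h hh
  rcases eq_or_ne h 0 with rfl | hne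
  · simp [h0]
  rw [screenedFunctional, if_pos rfl]
  have hpos : 0 < ‖h‖ := norm_pos_iff.2 hne
  refine le_trans (le_of_eq ?_) (mul_le_mul_right hh _)
  rw [← mul_assoc, ← ENNReal.ofReal_mul (by positivity), ← Real.rpow_add hpos]
  simp

/-- On the unit ball the weight is at least `1` away from the origin, so this is Jensen on a set of
finite measure. -/
theorem exists_lintegral_ball_le_screenedFunctional (n : ℕ) (hs : 0 < s) (hq : 1 ≤ q) :
    ∃ C : ℝ≥0, ∀ a : EuclideanSpace ℝ (Fin n) → ℝ≥0∞, Measurable a → a 0 = 0 →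
      ∫⁻ h in Metric.ball (0 : EuclideanSpace ℝ (Fin n)) 1, a h ≤
        C * screenedFunctional s q a := by
  set V := volume (Metric.ball (0 : EuclideanSpace ℝ (Fin n)) 1) with hVdef
  have hV : V ≠ ⊤ := measure_ball_lt_top.ne
  rcases eq_or_ne q ⊤ with rfl | hq'
  · refine ⟨V.toNNReal, fun a _ h0 => ?_⟩
    rw [ENNReal.coe_toNNReal hV, mul_comm, hVdef, ← setLIntegral_const]
    refine lintegral_mono_ae ?_
    filter_upwards [ae_le_screenedFunctional_top (s := s) h0,
      ae_restrict_mem Metric.isOpen_ball.measurableSet] with h hh hb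
    have hb : ‖h‖ < 1 := by simpa using hb
    refine hh.trans (mul_le_of_le_one_left zero_le ?_)
    rw [← ENNReal.ofReal_one]
    exact ENNReal.ofReal_le_ofReal (Real.rpow_le_one (norm_nonneg h) hb.le hs.le)
  have hQ : 1 ≤ q.toReal := by
    rw [← ENNReal.toReal_one]; exact ENNReal.toReal_mono hq' hq
  have hQ0 : 0 < q.toReal := by linarith
  have hC : (V ^ (q.toReal - 1)) ^ (1 / q.toReal) ≠ ⊤ :=
    ENNReal.rpow_ne_top_of_nonneg (by positivity) (ENNReal.rpow_ne_top_of_nonneg (by linarith) hV)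
  refine ⟨((V ^ (q.toReal - 1)) ^ (1 / q.toReal)).toNNReal, fun a ha h0 => ?_⟩
  rw [ENNReal.coe_toNNReal hC, screenedFunctional_of_ne_top hs hq hq',
    ← ENNReal.mul_rpow_of_nonneg _ _ (by positivity), one_div, ENNReal.le_rpow_inv_iff hQ0]
  refine (lintegral_rpow_le_measure_rpow_mul ha.aemeasurable hQ).trans ?_
  rw [Measure.restrict_apply_univ]
  refine mul_le_mul_right (setLIntegral_mono' Metric.isOpen_ball.measurableSet fun h hb => ?_) _
  have hb : ‖h‖ < 1 := by simpa using hb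
  rcases eq_or_ne h 0 with rfl | hne
  · simp [h0, hQ0]
  refine le_mul_of_one_le_left zero_le ?_
  rw [← ENNReal.ofReal_one]
  refine ENNReal.ofReal_le_ofReal (Real.one_le_rpow_of_pos_of_le_one_of_nonpos
    (norm_pos_iff.2 hne) hb.le ?_)
  have : 0 < s * q.toReal + n := by positivity
  linarith

theorem volume_ball_pos {t : ℝ} (ht : 0 < t) :
    volume (Metric.ball (0 : EuclideanSpace ℝ (Fin n)) t) ≠ 0 :=
  (Metric.measure_ball_pos volume _ ht).ne'

/-- A function of the radius that is dominated by averages of `a` at scales up to `1` and by the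
screened functional of `a` at larger scales has a Besov functional controlled by `a`. -/
theorem exists_besovFunctional_le (n : ℕ) (hs : 0 < s) (hq : 1 ≤ q) (K M : ℝ≥0) :
    ∃ C : ℝ≥0, ∀ (a : EuclideanSpace ℝ (Fin n) → ℝ≥0∞) (w : ℝ → ℝ≥0∞), Measurable a → a 0 = 0 →
      (∀ t ∈ Ioc (0 : ℝ) 1, w t * volume (Metric.ball (0 : EuclideanSpace ℝ (Fin n)) t) ≤
        K * ∫⁻ h in Metric.ball (0 : EuclideanSpace ℝ (Fin n)) t, a h) →
      (∀ t ∈ Ioi (1 : ℝ), w t ≤ M * screenedFunctional s q a) →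
      besovFunctional s q w ≤ C * screenedFunctional s q a := by
  rcases eq_or_ne q ⊤ with rfl | hq'
  · refine ⟨K + M, fun a w ha h0 hK hM => ?_⟩
    set N := screenedFunctional s ⊤ a
    rw [besovFunctional, if_pos rfl]
    refine iSup₂_le fun t (ht : 0 < t) => ?_
    rw [ENNReal.coe_add, add_mul]
    rcases le_or_gt t 1 with h1 | h1
    · refine le_add_right ?_
      have hb := hK t ⟨ht, h1⟩
      have hint : ∫⁻ h in Metric.ball (0 : EuclideanSpace ℝ (Fin n)) t, a h ≤
          (ENNReal.ofReal (t ^ s) * N) *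
            volume (Metric.ball (0 : EuclideanSpace ℝ (Fin n)) t) := by
        rw [← setLIntegral_const]
        refine lintegral_mono_ae ?_
        filter_upwards [ae_restrict_of_ae_restrict_of_subset (Metric.ball_subset_ball h1)
          (ae_le_screenedFunctional_top (s := s) h0),
          ae_restrict_mem Metric.isOpen_ball.measurableSet] with h hh hb
        have hb : ‖h‖ < t := by simpa using hb
        refine hh.trans (mul_le_mul_left (ENNReal.ofReal_le_ofReal ?_) _)
        exact Real.rpow_le_rpow (norm_nonneg h) hb.le hs.le
      have hw : w t ≤ K * (ENNReal.ofReal (t ^ s) * N) := by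
        have := hb.trans (mul_le_mul_right hint _)
        rw [← mul_assoc] at this
        exact (ENNReal.mul_le_mul_iff_left (volume_ball_pos ht) measure_ball_lt_top.ne).1 this
      refine (mul_le_mul_right hw _).trans (le_of_eq ?_)
      rw [mul_left_comm, ← mul_assoc (ENNReal.ofReal _), ← ENNReal.ofReal_mul (by positivity),
        ← Real.rpow_add ht]
      simp
    · refine le_add_left ((mul_le_of_le_one_left zero_le ?_).trans (hM t h1))
      rw [← ENNReal.ofReal_one]
      exact ENNReal.ofReal_le_ofReal (Real.rpow_le_one_of_one_le_of_nonpos h1.le (by linarith))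
  have hQ : 1 ≤ q.toReal := by
    rw [← ENNReal.toReal_one]; exact ENNReal.toReal_mono hq' hq
  set Q := q.toReal with hQdef
  have hQ0 : 0 < Q := by linarith
  set β := s * Q + n with hβdef
  have hβ : 0 < β := by positivity
  set V := volume (Metric.ball (0 : EuclideanSpace ℝ (Fin n)) 1)
  have hV : V ≠ ⊤ := measure_ball_lt_top.ne
  have hV0 : V ≠ 0 := volume_ball_pos one_pos
  -- `C₁` accounts for `t ≤ 1`, with `1/β` from integrating `t ^ (-β - 1)` over `t > ‖h‖`. `C₂`
  -- accounts for `t > 1`, with `1/(sQ)` from integrating `t ^ (-sQ - 1)`.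
  set C₁ : ℝ≥0∞ := K ^ Q * V⁻¹ * ENNReal.ofReal (1 / β)
  set C₂ : ℝ≥0∞ := ENNReal.ofReal (1 / (s * Q)) * M ^ Q
  have hC₁ : C₁ ≠ ⊤ := by finiteness
  have hC₂ : C₂ ≠ ⊤ := by finiteness
  have hC : (C₁ + C₂) ^ (1 / Q) ≠ ⊤ := by finiteness
  refine ⟨((C₁ + C₂) ^ (1 / Q)).toNNReal, fun a w ha h0 hK hM => ?_⟩
  set N := screenedFunctional s q a with hN
  set I := ∫⁻ h in Metric.ball (0 : EuclideanSpace ℝ (Fin n)) 1,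
        ENNReal.ofReal (‖h‖ ^ (-β)) * a h ^ Q with hI
  have hNI : N = I ^ (1 / Q) := screenedFunctional_of_ne_top hs hq hq' a
  have hNQ : N ^ Q = I := by
    rw [hNI, ← ENNReal.rpow_mul, one_div_mul_cancel hQ0.ne', ENNReal.rpow_one]
  rw [ENNReal.coe_toNNReal hC, besovFunctional_of_ne_top hq', hNI,
    ← ENNReal.mul_rpow_of_nonneg _ _ (by positivity)]
  refine ENNReal.rpow_le_rpow ?_ (by positivity)
  rw [add_mul, ← Ioc_union_Ioi_eq_Ioi zero_le_one]
  refine (lintegral_union_le _ _ _).trans (add_le_add ?_ ?_)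
  · set F : EuclideanSpace ℝ (Fin n) → ℝ → ℝ≥0∞ := fun h t =>
      ENNReal.ofReal (t ^ (-β - 1)) * a h ^ Q
    set G : EuclideanSpace ℝ (Fin n) → ℝ → ℝ≥0∞ := fun h t => (Ioi ‖h‖).indicator (F h) t
    have hG : Measurable (Function.uncurry G) := by
      have : Function.uncurry G = {z : EuclideanSpace ℝ (Fin n) × ℝ | ‖z.1‖ < z.2}.indicator
          (fun z => ENNReal.ofReal (z.2 ^ (-β - 1)) * a z.1 ^ Q) := by
        ext z
        simp [G, F, Function.uncurry, indicator]
      rw [this]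
      refine Measurable.indicator ?_ measurableSet_norm_lt
      fun_prop
    have hpt : ∀ t ∈ Ioc (0 : ℝ) 1, ENNReal.ofReal (t ^ (-(s * Q) - 1)) * w t ^ Q ≤
        (K ^ Q * V⁻¹) * ∫⁻ h, G h t := by
      intro t ht
      set v := volume (Metric.ball (0 : EuclideanSpace ℝ (Fin n)) t) with hv
      have hvV : v = ENNReal.ofReal (t ^ n) * V := volume_ball_eq ht.1
      have hv0 : v ≠ 0 := volume_ball_pos ht.1
      have hvt : v ≠ ⊤ := measure_ball_lt_top.ne
      have h1 : w t ^ Q ≤ K ^ Q * v⁻¹ *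
          ∫⁻ h in Metric.ball (0 : EuclideanSpace ℝ (Fin n)) t, a h ^ Q := by
        -- Jensen costs `v ^ (Q - 1)`; dividing by `v ^ Q` leaves the normalised average.
        have h2 := ENNReal.rpow_le_rpow (hK t ht) hQ0.le
        rw [ENNReal.mul_rpow_of_nonneg _ _ hQ0.le, ENNReal.mul_rpow_of_nonneg _ _ hQ0.le] at h2
        have h3 := h2.trans (mul_le_mul_right
          (lintegral_rpow_le_measure_rpow_mul ha.aemeasurable hQ) _)
        rw [Measure.restrict_apply_univ, ← hv, ENNReal.rpow_sub _ _ hv0 hvt, ENNReal.rpow_one,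
          div_eq_mul_inv] at h3
        refine (ENNReal.mul_le_mul_iff_left (c := v ^ Q) ?_ ?_).1 (h3.trans (le_of_eq ?_))
        · simp [hv0, hvt]
        · exact ENNReal.rpow_ne_top_of_nonneg hQ0.le hvt
        · ring
      refine (mul_le_mul_right h1 _).trans (le_of_eq ?_)
      have h4 : ∫⁻ h, G h t = ENNReal.ofReal (t ^ (-β - 1)) *
          ∫⁻ h in Metric.ball (0 : EuclideanSpace ℝ (Fin n)) t, a h ^ Q := by
        rw [← lintegral_const_mul' _ _ ENNReal.ofReal_ne_top,
          ← lintegral_indicator Metric.isOpen_ball.measurableSet]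
        refine lintegral_congr fun h => ?_
        simp [G, F, indicator]
      have h5 : ENNReal.ofReal (t ^ (-(s * Q) - 1)) * v⁻¹ =
          V⁻¹ * ENNReal.ofReal (t ^ (-β - 1)) := by
        rw [hvV, ENNReal.mul_inv (Or.inr hV) (Or.inr hV0),
          ← ENNReal.ofReal_inv_of_pos (pow_pos ht.1 n), ← mul_assoc,
          ← ENNReal.ofReal_mul (Real.rpow_nonneg ht.1.le _), mul_comm, ← Real.rpow_natCast,
          ← Real.rpow_neg ht.1.le, ← Real.rpow_add ht.1]
        congr 3
        rw [hβdef]; ring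
      rw [h4]
      calc _ = (ENNReal.ofReal (t ^ (-(s * Q) - 1)) * v⁻¹) * (K ^ Q *
            ∫⁻ h in Metric.ball (0 : EuclideanSpace ℝ (Fin n)) t, a h ^ Q) := by ring
        _ = _ := by rw [h5]; ring
    -- For Tonelli: the inner integral over scales returns the screened weight, and vanishes for
    -- `‖h‖ ≥ 1` since `t ≤ 1`.
    have hinner : ∀ h : EuclideanSpace ℝ (Fin n), ∫⁻ t in Ioc (0 : ℝ) 1, G h t ≤
        ENNReal.ofReal (1 / β) * (Metric.ball (0 : EuclideanSpace ℝ (Fin n)) 1).indicator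
          (fun h => ENNReal.ofReal (‖h‖ ^ (-β)) * a h ^ Q) h := by
      intro h
      rcases eq_or_ne h 0 with rfl | hne
      · simp [G, F, h0, hQ0]
      have hpos : 0 < ‖h‖ := norm_pos_iff.2 hne
      by_cases hb : ‖h‖ < 1
      · rw [indicator_of_mem (by simpa using hb), setLIntegral_indicator measurableSet_Ioi]
        refine (lintegral_mono_set inter_subset_left).trans (le_of_eq ?_)
        simp only [F]
        rw [lintegral_mul_const _ (by fun_prop), lintegral_Ioi_rpow hβ hpos, ← mul_assoc,
          ← ENNReal.ofReal_mul (by positivity)]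
        congr 2
        ring
      · rw [indicator_of_notMem (by simpa using hb), mul_zero, nonpos_iff_eq_zero]
        refine setLIntegral_eq_zero measurableSet_Ioc fun t ht => ?_
        exact indicator_of_notMem (by simpa using ht.2.trans (not_lt.1 hb)) _
    calc ∫⁻ t in Ioc (0 : ℝ) 1, ENNReal.ofReal (t ^ (-(s * Q) - 1)) * w t ^ Q
        ≤ ∫⁻ t in Ioc (0 : ℝ) 1, (K ^ Q * V⁻¹) * ∫⁻ h, G h t :=
          setLIntegral_mono' measurableSet_Ioc hpt
      _ = (K ^ Q * V⁻¹) * ∫⁻ h, ∫⁻ t in Ioc (0 : ℝ) 1, G h t := by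
          rw [lintegral_const_mul' _ _ (by finiteness), lintegral_lintegral_swap hG.aemeasurable]
      _ ≤ (K ^ Q * V⁻¹) * (ENNReal.ofReal (1 / β) * I) := by
          refine mul_le_mul_right ?_ _
          rw [hI, ← lintegral_indicator Metric.isOpen_ball.measurableSet,
            ← lintegral_const_mul' _ _ ENNReal.ofReal_ne_top]
          exact lintegral_mono hinner
      _ = C₁ * I := by rw [← mul_assoc]
  · calc ∫⁻ t in Ioi (1 : ℝ), ENNReal.ofReal (t ^ (-(s * Q) - 1)) * w t ^ Q
        ≤ ∫⁻ t in Ioi (1 : ℝ), ENNReal.ofReal (t ^ (-(s * Q) - 1)) * (M * N) ^ Q :=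
          setLIntegral_mono' measurableSet_Ioi fun t ht =>
            mul_le_mul_right (ENNReal.rpow_le_rpow (hM t ht) hQ0.le) _
      _ = C₂ * I := by
          rw [lintegral_mul_const _ (by fun_prop), lintegral_Ioi_rpow (by positivity) one_pos,
            Real.one_rpow, ENNReal.mul_rpow_of_nonneg _ _ hQ0.le, hNQ, ← mul_assoc]

end Functionals

/-! ### An integral Minkowski inequality. -/

section Averages

variable {X Y G : Type*} [MeasurableSpace X] [MeasurableSpace Y] [NormedAddCommGroup G]
  [NormedSpace ℝ G] {μ : Measure X} [SFinite μ] {ν : Measure Y} [IsFiniteMeasure ν]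

/-- The bound `M` is uniform in `y`, so Jensen and Tonelli suffice for `p < ∞`; for `p = ∞` the two
almost-everywhere quantifiers are swapped. -/
theorem eLpNorm_integral_le_of_stronglyMeasurable {F : Y → X → G}
    (hF : StronglyMeasurable (Function.uncurry F)) {p M : ℝ≥0∞} (hp : 1 ≤ p)
    (hM : ∀ᵐ y ∂ν, eLpNorm (F y) p μ ≤ M) :
    eLpNorm (fun x => ∫ y, F y x ∂ν) p μ ≤ ν univ * M := by
  rcases eq_or_ne p ⊤ with rfl | hp'
  · have h1 : ∀ᵐ y ∂ν, ∀ᵐ x ∂μ, ‖F y x‖ₑ ≤ M := by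
      filter_upwards [hM] with y hy
      rw [eLpNorm_exponent_top] at hy
      exact (ENNReal.ae_le_essSup _).mono fun x hx => hx.trans hy
    have hm : MeasurableSet {z : Y × X | ‖F z.1 z.2‖ₑ ≤ M} :=
      measurableSet_le hF.enorm measurable_const
    rw [Measure.ae_ae_comm (p := fun y x => ‖F y x‖ₑ ≤ M) hm] at h1
    rw [eLpNorm_exponent_top]
    refine essSup_le_of_ae_le _ ?_
    filter_upwards [h1] with x hx
    calc ‖∫ y, F y x ∂ν‖ₑ ≤ ∫⁻ y, ‖F y x‖ₑ ∂ν := enorm_integral_le_lintegral_enorm _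
      _ ≤ ∫⁻ _, M ∂ν := lintegral_mono_ae hx
      _ = ν univ * M := by rw [lintegral_const, mul_comm]
  have hp0 : p ≠ 0 := (zero_lt_one.trans_le hp).ne'
  have hQ : 1 ≤ p.toReal := by
    rw [← ENNReal.toReal_one]; exact ENNReal.toReal_mono hp' hp
  have hQ0 : 0 < p.toReal := by linarith
  set Q := p.toReal
  have hFm : Measurable (Function.uncurry fun y x => ‖F y x‖ₑ ^ Q) := hF.enorm.pow_const Q
  rw [eLpNorm_eq_lintegral_rpow_enorm_toReal hp0 hp', one_div, ENNReal.rpow_inv_le_iff hQ0]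
  calc ∫⁻ x, ‖∫ y, F y x ∂ν‖ₑ ^ Q ∂μ
      ≤ ∫⁻ x, ν univ ^ (Q - 1) * ∫⁻ y, ‖F y x‖ₑ ^ Q ∂ν ∂μ := by
        refine lintegral_mono fun x => ?_
        refine (ENNReal.rpow_le_rpow (enorm_integral_le_lintegral_enorm _) hQ0.le).trans
          (lintegral_rpow_le_measure_rpow_mul ?_ hQ)
        exact (hF.enorm.comp (measurable_id.prodMk measurable_const)).aemeasurable
    _ = ν univ ^ (Q - 1) * ∫⁻ y, ∫⁻ x, ‖F y x‖ₑ ^ Q ∂μ ∂ν := by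
        rw [lintegral_const_mul' _ _
          (ENNReal.rpow_ne_top_of_nonneg (by linarith) (measure_ne_top ν univ)),
          lintegral_lintegral_swap hFm.aemeasurable]
    _ ≤ ν univ ^ (Q - 1) * ∫⁻ _, M ^ Q ∂ν := by
        refine mul_le_mul_right (lintegral_mono_ae ?_) _
        filter_upwards [hM] with y hy
        rwa [eLpNorm_eq_lintegral_rpow_enorm_toReal hp0 hp', one_div,
          ENNReal.rpow_inv_le_iff hQ0] at hy
    _ = (ν univ * M) ^ Q := by
        rw [lintegral_const, mul_comm (M ^ Q), ← mul_assoc, ENNReal.mul_rpow_of_nonneg _ _ hQ0.le]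
        congr 1
        nth_rewrite 2 [← ENNReal.rpow_one (ν univ)]
        rw [← ENNReal.rpow_add_of_nonneg _ _ (by linarith) zero_le_one, sub_add_cancel]

/-- Averaging a family of functions over a finite measure does not increase the `L^p` norm by more
than the total mass. -/
theorem eLpNorm_integral_le {F : Y → X → G}
    (hF : AEStronglyMeasurable (Function.uncurry F) (ν.prod μ)) {p M : ℝ≥0∞} (hp : 1 ≤ p)
    (hM : ∀ᵐ y ∂ν, eLpNorm (F y) p μ ≤ M) :
    eLpNorm (fun x => ∫ y, F y x ∂ν) p μ ≤ ν univ * M := by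
  obtain ⟨F', hF', hFF'⟩ := hF
  have h1 : ∀ᵐ y ∂ν, ∀ᵐ x ∂μ, F y x = F' (y, x) := Measure.ae_ae_of_ae_prod hFF'
  -- The exceptional null set is sliced both ways: in `x` for the norms of `F y`, in `y` for the
  -- integral.
  have h2 : ∀ᵐ x ∂μ, ∀ᵐ y ∂ν, F y x = F' (y, x) := by
    refine Measure.ae_ae_of_ae_prod (μ := μ) (ν := ν)
      (p := fun z : X × Y => F z.2 z.1 = F' (z.2, z.1)) ?_
    exact Measure.measurePreserving_swap.quasiMeasurePreserving.ae hFF'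
  have h3 : (fun x => ∫ y, F y x ∂ν) =ᵐ[μ] fun x => ∫ y, F' (y, x) ∂ν :=
    h2.mono fun x hx => integral_congr_ae hx
  rw [eLpNorm_congr_ae h3]
  refine eLpNorm_integral_le_of_stronglyMeasurable (F := fun y x => F' (y, x)) hF' hp ?_
  filter_upwards [h1, hM] with y hy hy'
  rwa [← eLpNorm_congr_ae hy]

end Averages

/-! ### Averages of translates and their adjoints on test functions. -/

section TranslationAverages

variable {n : ℕ} {𝕜 : Type*} [RCLike 𝕜] {Y : Type*} [MeasurableSpace Y] {ν : Measure Y}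
  [IsFiniteMeasure ν] {T : Y → EuclideanSpace ℝ (Fin n)} {f : EuclideanSpace ℝ (Fin n) → 𝕜}
  {R : ℝ}

/-- The average of the translates `f (· + T y)` with respect to `ν`. -/
def translationAverage (ν : Measure Y) (T : Y → EuclideanSpace ℝ (Fin n))
    (f : EuclideanSpace ℝ (Fin n) → 𝕜) : EuclideanSpace ℝ (Fin n) → 𝕜 :=
  fun x => ∫ y, f (x + T y) ∂ν

/-- Every fibre map is a translation. The shear carries measurability and integrability of `f` over
to `f (x + T y)` on the product. -/
theorem measurePreserving_shear_add (hT : Measurable T) :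
    MeasurePreserving (fun z : Y × EuclideanSpace ℝ (Fin n) => (z.1, z.2 + T z.1))
      (ν.prod volume) (ν.prod volume) :=
  (MeasurePreserving.id ν).skew_product (g := fun y x => x + T y)
    (measurable_snd.add (hT.comp measurable_fst))
    (.of_forall fun y => map_add_right_eq_self volume (T y))

theorem measurePreserving_shear_sub (hT : Measurable T) :
    MeasurePreserving (fun z : Y × EuclideanSpace ℝ (Fin n) => (z.1, z.2 - T z.1))
      (ν.prod volume) (ν.prod volume) := by
  simpa [sub_eq_add_neg] using measurePreserving_shear_add (ν := ν) hT.neg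

theorem aestronglyMeasurable_translate (hT : Measurable T) (hf : AEStronglyMeasurable f volume) :
    AEStronglyMeasurable (fun z : Y × EuclideanSpace ℝ (Fin n) => f (z.2 + T z.1))
      (ν.prod volume) :=
  hf.comp_quasiMeasurePreserving
    (Measure.quasiMeasurePreserving_snd.comp (measurePreserving_shear_add hT).quasiMeasurePreserving)

theorem eLpNorm_translationAverage_le (hT : Measurable T) (hf : AEStronglyMeasurable f volume)
    {p : ℝ≥0∞} (hp : 1 ≤ p) :
    eLpNorm (translationAverage ν T f) p volume ≤ ν univ * eLpNorm f p volume :=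
  eLpNorm_integral_le (F := fun y x => f (x + T y)) (aestronglyMeasurable_translate hT hf) hp
    (.of_forall fun y => (eLpNorm_comp_add hf p (T y)).le)

/-- Where `φ x ≠ 0`, the point `x + T y` stays in a fixed ball, so `f` can be replaced by an
integrable truncation and pulled back along the shear. -/
theorem integrable_smul_translate (hT : Measurable T) (hR : ∀ᵐ y ∂ν, ‖T y‖ ≤ R)
    (hf : LocallyIntegrable f volume) {φ : EuclideanSpace ℝ (Fin n) → ℝ} (hφ : Measurable φ)
    {C r : ℝ} (hC : ∀ x, ‖φ x‖ ≤ C) (hr : ∀ x, r < ‖x‖ → φ x = 0) :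
    Integrable (fun z : Y × EuclideanSpace ℝ (Fin n) => φ z.2 • f (z.2 + T z.1))
      (ν.prod volume) := by
  set K := Metric.closedBall (0 : EuclideanSpace ℝ (Fin n)) (r + R)
  have h1 : Integrable (K.indicator f) volume :=
    (integrable_indicator_iff Metric.isClosed_closedBall.measurableSet).2
      (hf.integrableOn_isCompact (isCompact_closedBall _ _))
  have h2 : Integrable (fun z : Y × EuclideanSpace ℝ (Fin n) => K.indicator f (z.2 + T z.1))
      (ν.prod volume) :=
    (measurePreserving_shear_add hT).integrable_comp_of_integrable (h1.comp_snd ν)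
  have h3 := h2.bdd_smul C (φ := fun z => φ z.2)
    (hφ.comp measurable_snd).aestronglyMeasurable (.of_forall fun z => hC z.2)
  refine h3.congr ?_
  filter_upwards [Measure.quasiMeasurePreserving_fst.ae hR] with z hz
  by_cases hx : r < ‖z.2‖
  · simp [hr _ hx]
  · rw [Pi.smul_apply', indicator_of_mem]
    rw [mem_closedBall_zero_iff]
    exact (norm_add_le _ _).trans (add_le_add (not_lt.1 hx) hz)

theorem integrableOn_closedBall_translate (hT : Measurable T) (hR : ∀ᵐ y ∂ν, ‖T y‖ ≤ R)
    (hf : LocallyIntegrable f volume) (r : ℝ) :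
    Integrable (fun z : Y × EuclideanSpace ℝ (Fin n) =>
      (Metric.closedBall (0 : EuclideanSpace ℝ (Fin n)) r).indicator (fun _ => (1 : ℝ)) z.2 •
        f (z.2 + T z.1)) (ν.prod volume) := by
  refine integrable_smul_translate hT hR hf (C := 1) (r := r)
    (measurable_const.indicator Metric.isClosed_closedBall.measurableSet) (fun x => ?_)
    (fun x hx => indicator_of_notMem (by simpa using hx) _)
  by_cases hx : x ∈ Metric.closedBall (0 : EuclideanSpace ℝ (Fin n)) r <;> simp [indicator, hx]

theorem locallyIntegrable_translationAverage (hT : Measurable T) (hR : ∀ᵐ y ∂ν, ‖T y‖ ≤ R)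
    (hf : LocallyIntegrable f volume) :
    LocallyIntegrable (translationAverage ν T f) volume := by
  rw [locallyIntegrable_iff]
  intro K hK
  obtain ⟨r, hr⟩ := hK.isBounded.subset_closedBall 0
  refine IntegrableOn.mono_set ?_ hr
  rw [← integrable_indicator_iff Metric.isClosed_closedBall.measurableSet]
  refine (integrableOn_closedBall_translate hT hR hf r).integral_prod_right.congr
    (.of_forall fun x => ?_)
  by_cases hx : x ∈ Metric.closedBall (0 : EuclideanSpace ℝ (Fin n)) r <;>
    simp [indicator, hx, translationAverage]

theorem ae_integrable_translate (hT : Measurable T) (hR : ∀ᵐ y ∂ν, ‖T y‖ ≤ R)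
    (hf : LocallyIntegrable f volume) :
    ∀ᵐ x, Integrable (fun y => f (x + T y)) ν := by
  have h (k : ℕ) := (integrableOn_closedBall_translate hT hR hf k).prod_left_ae
  filter_upwards [ae_all_iff.2 h] with x hx
  obtain ⟨k, hk⟩ := exists_nat_ge ‖x‖
  simpa [indicator, hk] using hx k

variable {φ : EuclideanSpace ℝ (Fin n) → ℝ}

theorem integrable_test_smul_translate (hT : Measurable T) (hR : ∀ᵐ y ∂ν, ‖T y‖ ≤ R)
    (hf : LocallyIntegrable f volume) (hφ : Continuous φ) (hφ' : HasCompactSupport φ) :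
    Integrable (fun z : Y × EuclideanSpace ℝ (Fin n) => φ z.2 • f (z.2 + T z.1))
      (ν.prod volume) := by
  obtain ⟨C, hC⟩ := hφ'.exists_bound_of_continuous hφ
  obtain ⟨r, hr⟩ := hφ'.isCompact.isBounded.subset_closedBall 0
  refine integrable_smul_translate hT hR hf hφ.measurable hC (r := r) fun x hx => ?_
  by_contra h0
  have := hr (subset_tsupport _ h0)
  rw [mem_closedBall_zero_iff] at this
  linarith

theorem integrable_test_translate_smul (hT : Measurable T) (hR : ∀ᵐ y ∂ν, ‖T y‖ ≤ R)
    (hf : LocallyIntegrable f volume) (hφ : Continuous φ) (hφ' : HasCompactSupport φ) :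
    Integrable (fun z : Y × EuclideanSpace ℝ (Fin n) => φ (z.2 - T z.1) • f z.2)
      (ν.prod volume) := by
  have := (measurePreserving_shear_sub hT).integrable_comp_of_integrable
    (integrable_test_smul_translate hT hR hf hφ hφ')
  refine this.congr (.of_forall fun z => ?_)
  simp

theorem integral_smul_translationAverage (hT : Measurable T) (hR : ∀ᵐ y ∂ν, ‖T y‖ ≤ R)
    (hf : LocallyIntegrable f volume) (hφ : Continuous φ) (hφ' : HasCompactSupport φ) :
    ∫ x, φ x • translationAverage ν T f x = ∫ y, ∫ x, φ (x - T y) • f x ∂volume ∂ν := by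
  calc ∫ x, φ x • translationAverage ν T f x = ∫ x, ∫ y, φ x • f (x + T y) ∂ν := by
        simp only [translationAverage, integral_smul]
    _ = ∫ y, ∫ x, φ x • f (x + T y) ∂volume ∂ν :=
        (integral_integral_swap (integrable_test_smul_translate hT hR hf hφ hφ')).symm
    _ = _ := by
        refine integral_congr_ae (.of_forall fun y => ?_)
        simp only
        rw [← integral_sub_right_eq_self _ (T y)]
        simp

/-- Fubini and translation invariance move the average onto the test function. -/
theorem integral_smul_translationAverage_eq (hT : Measurable T) (hR : ∀ᵐ y ∂ν, ‖T y‖ ≤ R)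
    (hf : LocallyIntegrable f volume) (hφ : Continuous φ) (hφ' : HasCompactSupport φ) :
    ∫ x, φ x • translationAverage ν T f x = ∫ x, (∫ y, φ (x - T y) ∂ν) • f x := by
  rw [integral_smul_translationAverage hT hR hf hφ hφ',
    integral_integral_swap (integrable_test_translate_smul hT hR hf hφ hφ')]
  refine integral_congr_ae (.of_forall fun x => ?_)
  exact integral_smul_const (fun y => φ (x - T y)) (f x)

theorem integrable_average_test_smul (hT : Measurable T) (hR : ∀ᵐ y ∂ν, ‖T y‖ ≤ R)
    (hf : LocallyIntegrable f volume) (hφ : Continuous φ) (hφ' : HasCompactSupport φ) :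
    Integrable fun x => (∫ y, φ (x - T y) ∂ν) • f x := by
  refine (integrable_test_translate_smul hT hR hf hφ hφ').integral_prod_right.congr
    (.of_forall fun x => ?_)
  exact integral_smul_const (fun y => φ (x - T y)) (f x)

theorem locallyIntegrable_comp_add (hf : LocallyIntegrable f volume)
    (h : EuclideanSpace ℝ (Fin n)) : LocallyIntegrable (fun x => f (x + h)) volume := by
  -- A single translate is the average over a Dirac mass.
  have := locallyIntegrable_translationAverage (ν := Measure.dirac ()) (T := fun _ => h)
    measurable_const (.of_forall fun _ => le_rfl) hf
  refine this.congr (.of_forall fun x => ?_)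
  simp [translationAverage]

theorem locallyIntegrable_fdiff (hf : LocallyIntegrable f volume)
    (h : EuclideanSpace ℝ (Fin n)) : LocallyIntegrable (fdiff h f) volume :=
  (locallyIntegrable_comp_add hf h).sub hf

theorem translationAverage_fdiff_ae_eq (hT : Measurable T) (hR : ∀ᵐ y ∂ν, ‖T y‖ ≤ R)
    (hf : LocallyIntegrable f volume) (h : EuclideanSpace ℝ (Fin n)) :
    translationAverage ν T (fdiff h f) =ᵐ[volume]
      fun x => translationAverage ν (fun y => T y + h) f x - translationAverage ν T f x := by
  filter_upwards [ae_integrable_translate hT hR hf,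
    ae_integrable_translate hT hR (locallyIntegrable_comp_add hf h)] with x h1 h2
  simp only [translationAverage, fdiff]
  rw [integral_sub h2 h1]
  simp only [add_assoc]

end TranslationAverages

/-! ### Increments of functions with weak derivatives. -/

section WeakDerivatives

variable {n : ℕ} {𝕜 : Type*} [RCLike 𝕜] {f g : EuclideanSpace ℝ (Fin n) → 𝕜}
  {φ : EuclideanSpace ℝ (Fin n) → ℝ}

theorem continuous_fderiv_apply (hφ : ContDiff ℝ (⊤ : ℕ∞) φ) (v : EuclideanSpace ℝ (Fin n)) :
    Continuous fun x => fderiv ℝ φ x v :=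
  (hφ.continuous_fderiv (by simp)).clm_apply continuous_const

theorem hasCompactSupport_fderiv_apply (hφ : HasCompactSupport φ)
    (v : EuclideanSpace ℝ (Fin n)) : HasCompactSupport fun x => fderiv ℝ φ x v :=
  hφ.fderiv_apply (𝕜 := ℝ) v

theorem contDiff_comp_sub (hφ : ContDiff ℝ (⊤ : ℕ∞) φ) (v : EuclideanSpace ℝ (Fin n)) :
    ContDiff ℝ (⊤ : ℕ∞) fun x => φ (x - v) :=
  hφ.comp (contDiff_id.sub contDiff_const)

theorem hasCompactSupport_comp_sub (hφ : HasCompactSupport φ) (v : EuclideanSpace ℝ (Fin n)) :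
    HasCompactSupport fun x => φ (x - v) := by
  simpa [sub_eq_add_neg, Function.comp_def] using hφ.comp_homeomorph (Homeomorph.addRight (-v))

/-- The fundamental theorem of calculus along a segment. -/
theorem integral_fderiv_segment (hφ : ContDiff ℝ (⊤ : ℕ∞) φ) (x v : EuclideanSpace ℝ (Fin n))
    {a b : ℝ} (hab : a ≤ b) :
    ∫ τ in Ioc a b, fderiv ℝ φ (x - τ • v) v = φ (x - a • v) - φ (x - b • v) := by
  have hd (τ : ℝ) : HasDerivAt (fun τ : ℝ => φ (x - τ • v)) (-fderiv ℝ φ (x - τ • v) v) τ := by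
    have h1 : HasDerivAt (fun τ : ℝ => x - τ • v) (-v) τ := by
      simpa using ((hasDerivAt_id τ).smul_const v).const_sub x
    have h2 := (hφ.differentiable (by simp) (x - τ • v)).hasFDerivAt.comp_hasDerivAt τ h1
    simpa [Function.comp_def] using h2
  have hc : Continuous fun τ : ℝ => -fderiv ℝ φ (x - τ • v) v :=
    ((continuous_fderiv_apply hφ v).comp (by fun_prop)).neg
  have h3 := intervalIntegral.integral_eq_sub_of_hasDerivAt (fun τ _ => hd τ)
    (hc.intervalIntegrable a b)
  rw [intervalIntegral.integral_of_le hab, integral_neg] at h3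
  linarith

theorem integrable_test_smul (hf : LocallyIntegrable f volume) (hφ : Continuous φ)
    (hφ' : HasCompactSupport φ) : Integrable (fun x => φ x • f x) volume :=
  hf.integrable_smul_left_of_hasCompactSupport hφ hφ'

/-- If `g` is a weak derivative of `f` in the direction `v`, then the increments of `f` in the
direction `v` are averages of translates of `g`. -/
theorem fdiff_ae_eq_translationAverage (hf : LocallyIntegrable f volume)
    (hg : LocallyIntegrable g volume) {v : EuclideanSpace ℝ (Fin n)}
    (h : ∀ φ : EuclideanSpace ℝ (Fin n) → ℝ, ContDiff ℝ (⊤ : ℕ∞) φ → HasCompactSupport φ →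
      ∫ x, fderiv ℝ φ x v • f x = -∫ x, φ x • g x) (t : ℝ) :
    fdiff (t • v) f =ᵐ[volume]
      fun x => t • translationAverage (volume.restrict (Ioc (0 : ℝ) 1)) (fun τ => τ • t • v) g x := by
  have hT : Measurable fun τ : ℝ => τ • t • v := by fun_prop
  have hR : ∀ᵐ τ ∂(volume.restrict (Ioc (0 : ℝ) 1)), ‖τ • t • v‖ ≤ ‖t • v‖ := by
    filter_upwards [ae_restrict_mem measurableSet_Ioc] with τ hτ
    rw [norm_smul, Real.norm_of_nonneg hτ.1.le]
    exact mul_le_of_le_one_left (norm_nonneg _) hτ.2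
  -- Both sides are tested against `φ`. Moving translations and the derivative onto `φ` reduces the
  -- claim to the fundamental theorem of calculus for `φ` along the segment from `x` to `x - t • v`.
  refine ae_eq_of_integral_contDiff_smul_eq (locallyIntegrable_fdiff hf _)
    ((locallyIntegrable_translationAverage hT hR hg).smul t) fun φ hφ hφ' => ?_
  have hD := continuous_fderiv_apply hφ v
  have hD' := hasCompactSupport_fderiv_apply hφ' v
  have e1 : ∫ x, φ x • fdiff (t • v) f x = ∫ x, (φ (x - t • v) - φ x) • f x := by
    have i1 : Integrable (fun x => φ x • f (x + t • v)) volume :=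
      integrable_test_smul (locallyIntegrable_comp_add hf _) hφ.continuous hφ'
    have i2 : Integrable (fun x => φ x • f x) volume := integrable_test_smul hf hφ.continuous hφ'
    have i3 : Integrable (fun x => φ (x - t • v) • f x) volume :=
      integrable_test_smul hf (contDiff_comp_sub hφ _).continuous (hasCompactSupport_comp_sub hφ' _)
    simp only [fdiff, smul_sub, sub_smul]
    rw [integral_sub i1 i2, integral_sub i3 i2, ← integral_sub_right_eq_self _ (t • v)]
    simp
  have e2 : ∫ x, φ x • t • translationAverage (volume.restrict (Ioc (0 : ℝ) 1))
        (fun τ => τ • t • v) g x =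
      -(t • ∫ x, fderiv ℝ φ x v • translationAverage (volume.restrict (Ioc (0 : ℝ) 1))
        (fun τ => τ • t • v) f x) := by
    have e3 (x : EuclideanSpace ℝ (Fin n)) (z : 𝕜) : φ x • t • z = t • φ x • z :=
      smul_comm _ _ _
    simp only [e3]
    rw [integral_smul, integral_smul_translationAverage hT hR hg hφ.continuous hφ',
      integral_smul_translationAverage hT hR hf hD hD', ← smul_neg, ← integral_neg]
    congr 1
    refine integral_congr_ae (.of_forall fun τ => ?_)
    have := h _ (contDiff_comp_sub hφ (τ • t • v)) (hasCompactSupport_comp_sub hφ' (τ • t • v))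
    simp only [fderiv_comp_sub] at this
    exact (neg_eq_iff_eq_neg.2 this).symm
  rw [e1, e2, integral_smul_translationAverage_eq hT hR hf hD hD', ← integral_smul, ← integral_neg]
  refine integral_congr_ae (.of_forall fun x => ?_)
  have h4 := integral_fderiv_segment hφ x (t • v) zero_le_one
  simp only [map_smul, zero_smul, sub_zero, one_smul] at h4
  rw [integral_smul] at h4
  simp only
  rw [← smul_assoc, h4, ← neg_smul, neg_sub]

theorem eLpNorm_fdiff_smul_le (hf : LocallyIntegrable f volume)
    (hg : LocallyIntegrable g volume) {v : EuclideanSpace ℝ (Fin n)}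
    (h : ∀ φ : EuclideanSpace ℝ (Fin n) → ℝ, ContDiff ℝ (⊤ : ℕ∞) φ → HasCompactSupport φ →
      ∫ x, fderiv ℝ φ x v • f x = -∫ x, φ x • g x) (t : ℝ) {p : ℝ≥0∞} (hp : 1 ≤ p) :
    eLpNorm (fdiff (t • v) f) p volume ≤ ENNReal.ofReal |t| * eLpNorm g p volume := by
  have hT : Measurable fun τ : ℝ => τ • t • v := by fun_prop
  rw [eLpNorm_congr_ae (fdiff_ae_eq_translationAverage hf hg h t)]
  refine (eLpNorm_const_smul_le (c := t)).trans ?_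
  rw [← ofReal_norm, Real.norm_eq_abs]
  refine mul_le_mul_right ((eLpNorm_translationAverage_le hT hg.aestronglyMeasurable hp).trans ?_) _
  simp

/-- The increment is split along the coordinate axes, where each step has length `|h j| ≤ ‖h‖`. -/
theorem eLpNorm_fdiff_le_sobolevSeminorm (hf : LocallyIntegrable f volume) {p : ℝ≥0∞}
    (hp : 1 ≤ p) (h : EuclideanSpace ℝ (Fin n)) :
    eLpNorm (fdiff h f) p volume ≤ ENNReal.ofReal ‖h‖ * sobolevSeminorm p f := by
  have h1 : ∑ j, h j • EuclideanSpace.single j (1 : ℝ) = h := by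
    ext i
    simp [Finset.sum_apply, Pi.single_apply]
  calc eLpNorm (fdiff h f) p volume
      ≤ ∑ j, eLpNorm (fdiff (h j • EuclideanSpace.single j (1 : ℝ)) f) p volume := by
        conv_lhs => rw [← h1]
        exact eLpNorm_fdiff_sum_le hf.aestronglyMeasurable hp _ _
    _ ≤ ∑ j, ENNReal.ofReal ‖h‖ * ⨅ (g) (_ : IsWeakPartial j f g), eLpNorm g p volume := by
        refine Finset.sum_le_sum fun j _ => ?_
        -- The factor `‖h‖` can enter the infimum only if nonzero: an empty infimum is `⊤`, and `0 *
        -- ⊤ = 0`.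
        rcases eq_or_ne h 0 with rfl | hne
        · simp [eLpNorm_fdiff_zero]
        have hpos : 0 < ‖h‖ := norm_pos_iff.2 hne
        simp only [ENNReal.mul_iInf_of_ne (ENNReal.ofReal_pos.2 hpos).ne' ENNReal.ofReal_ne_top]
        refine le_iInf₂ fun g hg => ?_
        refine (eLpNorm_fdiff_smul_le hf hg.2.1 hg.2.2 (h j) hp).trans
          (mul_le_mul_left (ENNReal.ofReal_le_ofReal ?_) _)
        exact PiLp.norm_apply_le h j
    _ = _ := by rw [sobolevSeminorm, Finset.mul_sum]

end WeakDerivatives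

/-! ### The unit cube as a product probability space. -/

section Cube

variable {n : ℕ}

/-- The uniform distribution on `(-1/2, 1/2)`. -/
def unitInterval : Measure ℝ := volume.restrict (Ioo (-(1 / 2)) (1 / 2))

instance : IsProbabilityMeasure unitInterval :=
  ⟨by rw [unitInterval, Measure.restrict_apply_univ, Real.volume_Ioo]; norm_num⟩

/-- Resampling one coordinate of a random vector with i.i.d. coordinates does not change its
distribution. -/
theorem measurePreserving_update {ι : Type*} [Fintype ι] [DecidableEq ι] (ρ : Measure ℝ)
    [IsProbabilityMeasure ρ] (j : ι) :
    MeasurePreserving (fun z : (ι → ℝ) × ℝ => Function.update z.1 j z.2)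
      ((Measure.pi fun _ => ρ).prod ρ) (Measure.pi fun _ => ρ) := by
  have hm : Measurable fun z : (ι → ℝ) × ℝ => Function.update z.1 j z.2 := by
    refine measurable_pi_iff.2 fun i => ?_
    rcases eq_or_ne i j with rfl | hij
    · simpa using measurable_snd
    · simpa [hij, Function.comp_def] using (measurable_pi_apply i).comp measurable_fst
  refine ⟨hm, (Measure.pi_eq fun s hs => ?_).symm⟩
  rw [Measure.map_apply hm (.univ_pi hs)]
  -- The preimage of a box frees the old `j`-th coordinate, a factor of mass `1`.
  have : (fun z : (ι → ℝ) × ℝ => Function.update z.1 j z.2) ⁻¹' univ.pi s =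
      univ.pi (Function.update s j univ) ×ˢ s j := by
    ext z
    simp only [mem_preimage, mem_pi, mem_univ, true_imp_iff, mem_prod]
    constructor
    · refine fun h => ⟨fun i => ?_, by simpa using h j⟩
      rcases eq_or_ne i j with rfl | hij
      · simp
      · simpa [hij] using h i
    · rintro ⟨h1, h2⟩ i
      rcases eq_or_ne i j with rfl | hij
      · simpa using h2
      · simpa [hij] using h1 i
  rw [this, Measure.prod_prod, Measure.pi_pi, ← Finset.prod_erase_mul _ _ (Finset.mem_univ j),
    ← Finset.prod_erase_mul Finset.univ (fun i => ρ (s i)) (Finset.mem_univ j)]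
  simp only [Function.update_self, measure_univ, mul_one]
  congr 1
  refine Finset.prod_congr rfl fun i hi => ?_
  rw [Function.update_of_ne (Finset.ne_of_mem_erase hi)]

theorem measurableSet_unitCube : MeasurableSet (unitCube n) := by
  have : unitCube n = ⋂ i, {y : EuclideanSpace ℝ (Fin n) | y i ∈ Ioo (-(1 / 2) : ℝ) (1 / 2)} := by
    ext y; simp [unitCube]
  rw [this]
  refine MeasurableSet.iInter fun i => ?_
  exact measurableSet_Ioo.preimage (by fun_prop : Measurable fun y : EuclideanSpace ℝ (Fin n) => y i)

theorem measurePreserving_toLp_unitCube :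
    MeasurePreserving (WithLp.toLp 2 : (Fin n → ℝ) → EuclideanSpace ℝ (Fin n))
      (Measure.pi fun _ => unitInterval) (volume.restrict (unitCube n)) := by
  have h := (PiLp.volume_preserving_toLp (Fin n)).restrict_preimage (measurableSet_unitCube (n := n))
  have h1 : (WithLp.toLp 2 : (Fin n → ℝ) → EuclideanSpace ℝ (Fin n)) ⁻¹' unitCube n =
      univ.pi fun _ => Ioo (-(1 / 2) : ℝ) (1 / 2) := by
    ext y; simp [unitCube]
  rwa [h1, volume_pi, Measure.restrict_pi_pi] at h

theorem measurePreserving_ofLp_unitCube :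
    MeasurePreserving (WithLp.ofLp : EuclideanSpace ℝ (Fin n) → (Fin n → ℝ))
      (volume.restrict (unitCube n)) (Measure.pi fun _ => unitInterval) :=
  MeasurePreserving.symm (MeasurableEquiv.toLp 2 (Fin n → ℝ)) measurePreserving_toLp_unitCube

theorem volume_unitCube : volume (unitCube n) = 1 := by
  have := measurePreserving_toLp_unitCube (n := n).measure_preimage MeasurableSet.univ.nullMeasurableSet
  simpa using this.symm

instance : IsProbabilityMeasure (volume.restrict (unitCube n)) :=
  ⟨by rw [Measure.restrict_apply_univ, volume_unitCube]⟩

theorem norm_le_of_mem_unitCube {y : EuclideanSpace ℝ (Fin n)} (hy : y ∈ unitCube n) :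
    ‖y‖ ≤ n := by
  have h1 : ∑ j, y j • EuclideanSpace.single j (1 : ℝ) = y := by
    ext i
    simp [Finset.sum_apply, Pi.single_apply]
  rw [← h1]
  refine (norm_sum_le _ _).trans ?_
  calc ∑ j, ‖y j • EuclideanSpace.single j (1 : ℝ)‖ ≤ ∑ _j : Fin n, (1 : ℝ) := by
        refine Finset.sum_le_sum fun j _ => ?_
        rw [norm_smul, PiLp.norm_single, norm_one, mul_one, Real.norm_eq_abs, abs_le]
        constructor <;> linarith [(hy j).1, (hy j).2]
    _ = n := by simp

theorem ae_norm_le_unitCube : ∀ᵐ y ∂(volume.restrict (unitCube n)), ‖y‖ ≤ n :=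
  (ae_restrict_mem measurableSet_unitCube).mono fun _ hy => norm_le_of_mem_unitCube hy

/-- The projection of the point `y` to the coordinate hyperplane `y j = 0`. -/
def flatten (j : Fin n) (y : EuclideanSpace ℝ (Fin n)) : EuclideanSpace ℝ (Fin n) :=
  y - y j • EuclideanSpace.single j (1 : ℝ)

theorem continuous_flatten (j : Fin n) : Continuous (flatten j) := by
  unfold flatten
  fun_prop

/-- Resampling coordinate `j` allows Fubini in direction `e_j` without factoring the space. -/
theorem measurePreserving_flatten_add (j : Fin n) :
    MeasurePreserving (fun z : EuclideanSpace ℝ (Fin n) × ℝ =>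
        flatten j z.1 + z.2 • EuclideanSpace.single j (1 : ℝ))
      ((volume.restrict (unitCube n)).prod unitInterval) (volume.restrict (unitCube n)) := by
  have h := measurePreserving_toLp_unitCube.comp ((measurePreserving_update unitInterval j).comp
    ((measurePreserving_ofLp_unitCube (n := n)).prod (MeasurePreserving.id unitInterval)))
  convert h using 1
  ext z i
  rcases eq_or_ne i j with rfl | hij
  · simp [flatten]
  · simp [flatten, hij]

theorem norm_flatten_add_le (j : Fin n) (y : EuclideanSpace ℝ (Fin n)) (c : ℝ) :
    ‖flatten j y + c • EuclideanSpace.single j (1 : ℝ)‖ ≤ 2 * ‖y‖ + |c| := by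
  refine (norm_add_le _ _).trans (add_le_add ((norm_sub_le _ _).trans ?_) ?_)
  · rw [norm_smul, PiLp.norm_single, norm_one, mul_one, two_mul]
    exact add_le_add le_rfl (PiLp.norm_apply_le y j)
  · rw [norm_smul, PiLp.norm_single, norm_one, mul_one, Real.norm_eq_abs]

/-- The derivative is integrated in the resampled coordinate, leaving the difference between
opposite faces; face averages are written as cube averages via `flatten`. -/
theorem integral_unitCube_fderiv {φ : EuclideanSpace ℝ (Fin n) → ℝ}
    (hφ : ContDiff ℝ (⊤ : ℕ∞) φ) (hφ' : HasCompactSupport φ) (j : Fin n)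
    (x : EuclideanSpace ℝ (Fin n)) :
    ∫ y in unitCube n, fderiv ℝ φ (x - y) (EuclideanSpace.single j 1) =
      ∫ y in unitCube n, (φ (x - (flatten j y + (-(1 / 2) : ℝ) • EuclideanSpace.single j 1)) -
        φ (x - (flatten j y + (1 / 2 : ℝ) • EuclideanSpace.single j 1))) := by
  set e : EuclideanSpace ℝ (Fin n) := EuclideanSpace.single j 1
  have hD : Continuous fun y => fderiv ℝ φ (x - y) e :=
    (continuous_fderiv_apply hφ e).comp (by fun_prop)
  obtain ⟨C, hC⟩ := (hasCompactSupport_fderiv_apply hφ' e).exists_bound_of_continuous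
    (continuous_fderiv_apply hφ e)
  have hS := measurePreserving_flatten_add (n := n) j
  have hc : Continuous fun z : EuclideanSpace ℝ (Fin n) × ℝ =>
      fderiv ℝ φ (x - (flatten j z.1 + z.2 • e)) e :=
    hD.comp (((continuous_flatten j).comp continuous_fst).add (by fun_prop))
  calc ∫ y in unitCube n, fderiv ℝ φ (x - y) e
      = ∫ z, fderiv ℝ φ (x - (flatten j z.1 + z.2 • e)) e
          ∂((volume.restrict (unitCube n)).prod unitInterval) := by
        conv_lhs => rw [← hS.map_eq]
        rw [integral_map hS.aemeasurable hD.aestronglyMeasurable]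
    _ = ∫ y in unitCube n, ∫ τ, fderiv ℝ φ (x - (flatten j y + τ • e)) e ∂unitInterval := by
        refine integral_prod _ (Integrable.of_bound hc.aestronglyMeasurable C (.of_forall fun z => ?_))
        exact hC _
    _ = _ := by
        refine integral_congr_ae (.of_forall fun y => ?_)
        simp only [unitInterval]
        rw [← integral_Ioc_eq_integral_Ioo]
        simp only [← sub_sub]
        exact integral_fderiv_segment hφ (x - flatten j y) e (by norm_num)

end Cube

/-! ### The averaged part is weakly differentiable. -/

section LowPart

variable {n : ℕ} {𝕜 : Type*} [RCLike 𝕜] {f : EuclideanSpace ℝ (Fin n) → 𝕜}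

theorem lowPart_eq_translationAverage (f : EuclideanSpace ℝ (Fin n) → 𝕜) :
    lowPart f = translationAverage (volume.restrict (unitCube n)) (fun y => y) f := rfl

theorem locallyIntegrable_lowPart (hf : LocallyIntegrable f volume) :
    LocallyIntegrable (lowPart f) volume :=
  locallyIntegrable_translationAverage measurable_id ae_norm_le_unitCube hf

/-- Differentiating a cube average gives the difference of its averages over two opposite faces.
These are one unit vector `e_j` apart, so the difference is the average of `Δ_{e_j} f` over the
lower face. -/
theorem isWeakPartial_lowPart (hf : LocallyIntegrable f volume) (j : Fin n) :
    IsWeakPartial j (lowPart f) (translationAverage (volume.restrict (unitCube n))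
      (fun y => flatten j y + (-(1 / 2) : ℝ) • EuclideanSpace.single j 1)
      (fdiff (EuclideanSpace.single j 1) f)) := by
  set e : EuclideanSpace ℝ (Fin n) := EuclideanSpace.single j 1 with he
  have hT (c : ℝ) : Measurable fun y => flatten j y + c • e :=
    (continuous_flatten j).measurable.add_const _
  have hR (c : ℝ) : ∀ᵐ y ∂(volume.restrict (unitCube n)), ‖flatten j y + c • e‖ ≤ 2 * n + |c| :=
    ae_norm_le_unitCube.mono fun y hy => (norm_flatten_add_le j y c).trans (by linarith)
  refine ⟨locallyIntegrable_lowPart hf, locallyIntegrable_translationAverage (hT _) (hR _)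
    (locallyIntegrable_fdiff hf _), fun φ hφ hφ' => ?_⟩
  have h1 := translationAverage_fdiff_ae_eq (hT (-(1 / 2))) (hR (-(1 / 2))) hf e
  have h2 : (fun y => flatten j y + (-(1 / 2) : ℝ) • e + e) =
      fun y => flatten j y + (1 / 2 : ℝ) • e := by
    ext1 y
    nth_rewrite 2 [← one_smul ℝ e]
    rw [add_assoc, ← add_smul]
    norm_num
  rw [h2] at h1
  have iA (c : ℝ) : Integrable (fun x => φ x • translationAverage (volume.restrict (unitCube n))
      (fun y => flatten j y + c • e) f x) volume :=
    integrable_test_smul (locallyIntegrable_translationAverage (hT c) (hR c) hf) hφ.continuous hφ'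
  have iB (c : ℝ) : Integrable (fun x => (∫ y in unitCube n, φ (x - (flatten j y + c • e))) • f x)
      volume := integrable_average_test_smul (hT c) (hR c) hf hφ.continuous hφ'
  have iC (c : ℝ) (x : EuclideanSpace ℝ (Fin n)) : Integrable
      (fun y => φ (x - (flatten j y + c • e))) (volume.restrict (unitCube n)) := by
    obtain ⟨C, hC⟩ := hφ'.exists_bound_of_continuous hφ.continuous
    refine Integrable.of_bound (Continuous.aestronglyMeasurable ?_) C (.of_forall fun z => hC _)
    exact hφ.continuous.comp (continuous_const.sub ((continuous_flatten j).add continuous_const))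
  have h3 : ∫ x, φ x • translationAverage (volume.restrict (unitCube n))
      (fun y => flatten j y + (-(1 / 2) : ℝ) • e) (fdiff e f) x =
      (∫ x, (∫ y in unitCube n, φ (x - (flatten j y + (1 / 2 : ℝ) • e))) • f x) -
      ∫ x, (∫ y in unitCube n, φ (x - (flatten j y + (-(1 / 2) : ℝ) • e))) • f x := by
    rw [integral_congr_ae (h1.mono fun x hx => congrArg (φ x • ·) hx)]
    simp only [smul_sub]
    rw [integral_sub (iA _) (iA _),
      integral_smul_translationAverage_eq (hT _) (hR _) hf hφ.continuous hφ',
      integral_smul_translationAverage_eq (hT _) (hR _) hf hφ.continuous hφ']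
  rw [← he, h3, lowPart_eq_translationAverage, integral_smul_translationAverage_eq measurable_id'
    ae_norm_le_unitCube hf (continuous_fderiv_apply hφ e) (hasCompactSupport_fderiv_apply hφ' e),
    neg_sub, ← integral_sub (iB _) (iB _)]
  refine integral_congr_ae (.of_forall fun x => ?_)
  simp only
  rw [integral_unitCube_fderiv hφ hφ' j x, integral_sub (iC _ x) (iC _ x), sub_smul]

theorem sobolevSeminorm_lowPart_le (hf : LocallyIntegrable f volume) {p : ℝ≥0∞} (hp : 1 ≤ p) :
    sobolevSeminorm p (lowPart f) ≤ n * modulus p 1 f := by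
  calc sobolevSeminorm p (lowPart f) ≤ ∑ _j : Fin n, modulus p 1 f := by
        refine Finset.sum_le_sum fun j _ => ?_
        refine (iInf₂_le _ (isWeakPartial_lowPart hf j)).trans ?_
        refine (eLpNorm_translationAverage_le ((continuous_flatten j).measurable.add_const _)
          (aestronglyMeasurable_fdiff hf.aestronglyMeasurable _) hp).trans ?_
        rw [measure_univ, one_mul]
        exact eLpNorm_fdiff_le_modulus (by simp)
    _ = n * modulus p 1 f := by simp

end LowPart

/-! ### The oscillating part and the two embeddings. -/

section HighPart

variable {n : ℕ} {𝕜 : Type*} [RCLike 𝕜] {f : EuclideanSpace ℝ (Fin n) → 𝕜} {p q : ℝ≥0∞} {s : ℝ}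

/-- The identity holds at every point: the cube is bounded, so `f (x + ·)` is integrable on it for
each `x`. -/
theorem highPart_eq_sub (hf : LocallyIntegrable f volume) : highPart f = f - lowPart f := by
  ext x
  have h1 : IntegrableOn (fun y => f (x + y)) (unitCube n) volume := by
    have h2 := (locallyIntegrable_comp_add hf x).integrableOn_isCompact
      (isCompact_closedBall (0 : EuclideanSpace ℝ (Fin n)) n)
    simp only [add_comm _ x] at h2
    exact h2.mono_set fun y hy => by simpa using norm_le_of_mem_unitCube hy
  rw [highPart, integral_sub (integrable_const _) h1]
  simp [lowPart]

theorem locallyIntegrable_highPart (hf : LocallyIntegrable f volume) :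
    LocallyIntegrable (highPart f) volume := by
  rw [highPart_eq_sub hf]
  exact hf.sub (locallyIntegrable_lowPart hf)

theorem eLpNorm_highPart_le (hf : LocallyIntegrable f volume) (hp : 1 ≤ p) :
    eLpNorm (highPart f) p volume ≤ n * modulus p 1 f := by
  have hm := hf.aestronglyMeasurable
  have h := eLpNorm_integral_le (μ := volume) (ν := volume.restrict (unitCube n))
    (F := fun y x => f x - f (x + y)) (p := p) (M := n * modulus p 1 f)
    (hm.comp_snd.sub (aestronglyMeasurable_translate measurable_id hm)) hp ?_
  · rwa [measure_univ, one_mul] at h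
  filter_upwards [ae_norm_le_unitCube] with y hy
  have e1 : (fun x => f x - f (x + y)) = -fdiff y f := by ext x; simp [fdiff]
  rw [e1, eLpNorm_neg]
  rcases Nat.eq_zero_or_pos n with rfl | hn
  · rw [Subsingleton.elim y 0, eLpNorm_fdiff_zero]
    exact zero_le
  have hn' : (0 : ℝ) < n := Nat.cast_pos.2 hn
  -- Points of the cube have norm at most `n`, so `n` equal steps of length at most `1` reach `y`.
  have e2 : y = n • ((n : ℝ)⁻¹ • y) := by
    rw [← Nat.cast_smul_eq_nsmul ℝ, smul_inv_smul₀ hn'.ne']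
  rw [e2]
  refine (eLpNorm_fdiff_nsmul_le hm hp n _).trans (mul_le_mul_right ?_ _)
  refine eLpNorm_fdiff_le_modulus ?_
  rw [norm_smul, norm_inv, Real.norm_natCast, inv_mul_le_one₀ hn']
  exact hy

theorem fdiff_lowPart_ae_eq (hf : LocallyIntegrable f volume) (h : EuclideanSpace ℝ (Fin n)) :
    fdiff h (lowPart f) =ᵐ[volume] lowPart (fdiff h f) := by
  filter_upwards [translationAverage_fdiff_ae_eq measurable_id' ae_norm_le_unitCube hf h] with x hx
  rw [lowPart_eq_translationAverage (fdiff h f), hx]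
  simp only [fdiff, lowPart, translationAverage]
  congr 2
  ext y
  congr 1
  abel

/-- `𝕃` commutes with `Δ_h` almost everywhere and is a contraction of `L^p`. -/
theorem eLpNorm_fdiff_highPart_le (hf : LocallyIntegrable f volume) (hp : 1 ≤ p)
    (h : EuclideanSpace ℝ (Fin n)) :
    eLpNorm (fdiff h (highPart f)) p volume ≤ 2 * eLpNorm (fdiff h f) p volume := by
  have hm := aestronglyMeasurable_fdiff hf.aestronglyMeasurable h
  have e1 : fdiff h (highPart f) = fdiff h f - fdiff h (lowPart f) := by
    rw [highPart_eq_sub hf]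
    ext x
    simp only [fdiff, Pi.sub_apply]
    ring
  rw [e1, two_mul]
  refine (eLpNorm_sub_le hm (aestronglyMeasurable_fdiff
    (locallyIntegrable_lowPart hf).aestronglyMeasurable h) hp).trans (add_le_add le_rfl ?_)
  rw [eLpNorm_congr_ae (fdiff_lowPart_ae_eq hf h), lowPart_eq_translationAverage]
  refine (eLpNorm_translationAverage_le measurable_id hm hp).trans ?_
  rw [measure_univ, one_mul]

theorem modulus_highPart_le (hf : LocallyIntegrable f volume) (hp : 1 ≤ p) (t : ℝ) :
    modulus p t (highPart f) ≤ 2 * modulus p t f :=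
  iSup₂_le fun h hh => (eLpNorm_fdiff_highPart_le hf hp h).trans
    (mul_le_mul_right (eLpNorm_fdiff_le_modulus (by simpa using hh)) _)

theorem modulus_le_two_mul_eLpNorm (hf : AEStronglyMeasurable f volume) (hp : 1 ≤ p) (t : ℝ) :
    modulus p t f ≤ 2 * eLpNorm f p volume :=
  iSup₂_le fun h _ => eLpNorm_fdiff_le hf hp h

theorem volume_ball_half {t : ℝ} (ht : 0 < t) :
    volume (Metric.ball (0 : EuclideanSpace ℝ (Fin n)) t) =
      volume (Metric.ball (0 : EuclideanSpace ℝ (Fin n)) (t / 2)) * 2 ^ n := by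
  rw [volume_ball_eq ht, volume_ball_eq (half_pos ht), mul_right_comm, div_pow,
    ENNReal.ofReal_div_of_pos (by positivity), ENNReal.ofReal_pow (by norm_num : (0 : ℝ) ≤ 2),
    ENNReal.ofReal_ofNat, ENNReal.div_mul_cancel (by simp) (by finiteness)]

/-- The link from the screened seminorm to `‖ℍ f‖_{L^p}` and the derivatives of `𝕃 f`: the averaging
bound at `t = 1` meets the `L^1` bound on the unit ball. -/
theorem exists_modulus_one_le (n : ℕ) {𝕜 : Type*} [RCLike 𝕜] (hp : 1 ≤ p) (hq : 1 ≤ q)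
    (hs : 0 < s) :
    ∃ C : ℝ≥0, ∀ f : EuclideanSpace ℝ (Fin n) → 𝕜, AEStronglyMeasurable f volume →
      modulus p 1 f ≤ C * screenedSeminorm s p q f := by
  obtain ⟨C, hC⟩ := exists_lintegral_ball_le_screenedFunctional (s := s) (q := q) n hs hq
  set v := volume (Metric.ball (0 : EuclideanSpace ℝ (Fin n)) (1 / 2))
  have hv : v ≠ 0 := volume_ball_pos (by norm_num)
  have hv' : v ≠ ⊤ := measure_ball_lt_top.ne
  have hD : 2 * C * v⁻¹ ≠ ⊤ := by finiteness
  refine ⟨(2 * C * v⁻¹).toNNReal, fun f hf => ?_⟩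
  rw [ENNReal.coe_toNNReal hD]
  have h1 := (modulus_mul_volume_ball_le (t := 1) hf hp).trans
    (mul_le_mul_right (hC _ (measurable_eLpNorm_fdiff hf p) eLpNorm_fdiff_zero) 2)
  rw [← ENNReal.le_div_iff_mul_le (Or.inl hv) (Or.inl hv')] at h1
  refine h1.trans (le_of_eq ?_)
  rw [div_eq_mul_inv, ← mul_assoc, mul_right_comm]
  rfl

/-- The decomposition `f = ℍ f + 𝕃 f` is bounded. -/
theorem exists_besovNorm_highPart_add_le (n : ℕ) (𝕜 : Type*) [RCLike 𝕜] (hp : 1 ≤ p)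
    (hq : 1 ≤ q) (hs : 0 < s) :
    ∃ C : ℝ≥0, ∀ f : EuclideanSpace ℝ (Fin n) → 𝕜, LocallyIntegrable f volume →
      besovNorm s p q (highPart f) + sobolevSeminorm p (lowPart f) ≤
        C * screenedSeminorm s p q f := by
  obtain ⟨C₁, hC₁⟩ := exists_modulus_one_le (𝕜 := 𝕜) (s := s) n hp hq hs
  -- Applied with `a` from `f` and `w` from `ℍ f`. In `2 ^ n * 4`, one factor `2` is the cost of
  -- `ℍ`, the other that of averaging, and `2 ^ n` that of halving the ball. In `2 * (n * C₁)`, the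
  -- `2` is from `ω_p ≤ 2 ‖·‖` and the rest bounds `‖ℍ f‖`.
  obtain ⟨C₂, hC₂⟩ := exists_besovFunctional_le (s := s) (q := q) n hs hq (2 ^ n * 4)
    (2 * (n * C₁))
  refine ⟨n * C₁ + C₂ + n * C₁, fun f hf => ?_⟩
  set N := screenedSeminorm s p q f
  have hm := hf.aestronglyMeasurable
  have hω : (n : ℝ≥0∞) * modulus p 1 f ≤ (n * C₁ : ℝ≥0) * N := by
    rw [ENNReal.coe_mul, ENNReal.coe_natCast, mul_assoc]
    exact mul_le_mul_right (hC₁ f hm) _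
  have hH := (eLpNorm_highPart_le hf hp).trans hω
  have hB : besovSeminorm s p q (highPart f) ≤ C₂ * N := by
    refine hC₂ (fun h => eLpNorm (fdiff h f) p volume) (fun t => modulus p t (highPart f))
      (measurable_eLpNorm_fdiff hm p) eLpNorm_fdiff_zero (fun t ht => ?_) (fun t _ => ?_)
    · rw [volume_ball_half ht.1, ← mul_assoc]
      calc modulus p t (highPart f) *
            volume (Metric.ball (0 : EuclideanSpace ℝ (Fin n)) (t / 2)) * 2 ^ n
          ≤ 2 * modulus p t f *
            volume (Metric.ball (0 : EuclideanSpace ℝ (Fin n)) (t / 2)) * 2 ^ n := by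
            gcongr
            exact modulus_highPart_le hf hp t
        _ ≤ 2 * (2 * ∫⁻ h in Metric.ball (0 : EuclideanSpace ℝ (Fin n)) t,
              eLpNorm (fdiff h f) p volume) * 2 ^ n := by
            rw [mul_assoc 2]
            exact mul_le_mul_left (mul_le_mul_right (modulus_mul_volume_ball_le hm hp) 2) _
        _ = _ := by
            push_cast
            ring
    · refine (modulus_le_two_mul_eLpNorm
        (locallyIntegrable_highPart hf).aestronglyMeasurable hp t).trans ?_
      rw [ENNReal.coe_mul 2, mul_assoc]
      exact mul_le_mul_right hH _
  have hL := (sobolevSeminorm_lowPart_le hf hp).trans hω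
  rw [besovNorm, ENNReal.coe_add, ENNReal.coe_add, add_mul, add_mul]
  exact add_le_add (add_le_add hH hB) hL

/-- The sum of the Besov and the Sobolev space embeds into the screened Besov space. -/
theorem exists_screenedSeminorm_add_le {n : ℕ} (hn : 0 < n) (𝕜 : Type*) [RCLike 𝕜] (hp : 1 ≤ p)
    (hq : 1 ≤ q) (hs : s ∈ Ioo (0 : ℝ) 1) :
    ∃ C : ℝ≥0, ∀ f g : EuclideanSpace ℝ (Fin n) → 𝕜, LocallyIntegrable f volume →
      LocallyIntegrable g volume →
      screenedSeminorm s p q (f + g) ≤ C * (besovNorm s p q f + sobolevSeminorm p g) := by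
  obtain ⟨C₁, hC₁⟩ := exists_screenedFunctional_norm_le (s := s) (q := q) n hs.1 hq
  have hD := screenedFunctional_norm_lt_top (q := q) hn hs hq
  set D := screenedFunctional s q (fun h : EuclideanSpace ℝ (Fin n) => ENNReal.ofReal ‖h‖)
  -- The added `1` keeps the coefficient nonzero, so the bound is `⊤` when the Sobolev seminorm is.
  refine ⟨C₁ + (D.toNNReal + 1), fun f g hf hg => ?_⟩
  have hfm := hf.aestronglyMeasurable
  have hgm := hg.aestronglyMeasurable
  have h1 : screenedSeminorm s p q (f + g) ≤ screenedSeminorm s p q f + screenedSeminorm s p q g :=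
    (screenedFunctional_mono fun h => eLpNorm_fdiff_add_fun_le hfm hgm hp h).trans
      (screenedFunctional_add_le hs.1 hq (measurable_eLpNorm_fdiff hfm p)
        (measurable_eLpNorm_fdiff hgm p))
  have h2 : screenedSeminorm s p q f ≤ C₁ * besovNorm s p q f :=
    ((screenedFunctional_mono fun h => eLpNorm_fdiff_le_modulus le_rfl).trans
      (hC₁ (fun t => modulus p t f) modulus_mono)).trans
        (mul_le_mul_right (le_add_left le_rfl) _)
  have h3 : screenedSeminorm s p q g ≤ (D.toNNReal + 1 : ℝ≥0) * sobolevSeminorm p g := by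
    rcases eq_or_ne (sobolevSeminorm p g) ⊤ with h | h
    · rw [h, ENNReal.mul_top (by simp)]
      exact le_top
    · rw [ENNReal.coe_add, ENNReal.coe_toNNReal hD.ne, mul_comm]
      refine (screenedFunctional_mono fun x => ?_).trans
        ((screenedFunctional_const_mul hs.1 hq h).le.trans (mul_le_mul_right le_self_add _))
      rw [mul_comm]
      exact eLpNorm_fdiff_le_sobolevSeminorm hg hp x
  refine h1.trans ((add_le_add h2 h3).trans ?_)
  rw [mul_add]
  exact add_le_add (mul_le_mul_left (by simp) _) (mul_le_mul_left (by simp) _)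

theorem sobolevSeminorm_lt_top (hf : f ∈ sobolevSpace n 𝕜 p) : sobolevSeminorm p f < ⊤ :=
  ENNReal.sum_lt_top.2 fun j _ => by
    obtain ⟨g, hg, hg'⟩ := hf.2 j
    exact (iInf₂_le g hg).trans_lt hg'.2

theorem mem_sobolevSpace (hf : LocallyIntegrable f volume) (h : sobolevSeminorm p f < ⊤) :
    f ∈ sobolevSpace n 𝕜 p := by
  refine ⟨hf, fun j => ?_⟩
  have hj := ENNReal.sum_lt_top.1 h j (Finset.mem_univ j)
  obtain ⟨g, hg⟩ := iInf_lt_iff.1 hj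
  obtain ⟨hw, hg⟩ := iInf_lt_iff.1 hg
  exact ⟨g, hw, hw.2.1.aestronglyMeasurable, hg⟩

end HighPart

end ScreenedBesov

end

/-! ### The main theorem. -/

theorem mainTheorem3 {𝕜 : Type*} [RCLike 𝕜] (n : ℕ) (hn : 0 < n) (p q : ℝ≥0∞)
    (hp : 1 ≤ p) (hq : 1 ≤ q) (s : ℝ) (hs : s ∈ Set.Ioo (0 : ℝ) 1) :
    (∃ c : ℝ≥0, 0 < c ∧ ∀ f : EuclideanSpace ℝ (Fin n) → 𝕜, LocallyIntegrable f volume →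
      (c : ℝ≥0∞)⁻¹ * ScreenedBesov.screenedSeminorm s p q f ≤
          ScreenedBesov.besovNorm s p q (ScreenedBesov.highPart f) +
            ScreenedBesov.sobolevSeminorm p (ScreenedBesov.lowPart f) ∧
        ScreenedBesov.besovNorm s p q (ScreenedBesov.highPart f) +
            ScreenedBesov.sobolevSeminorm p (ScreenedBesov.lowPart f) ≤
          (c : ℝ≥0∞) * ScreenedBesov.screenedSeminorm s p q f) ∧
    ScreenedBesov.screenedSpace n 𝕜 s p q =
      ScreenedBesov.besovSpace n 𝕜 s p q + ScreenedBesov.sobolevSpace n 𝕜 p ∧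
    (∃ c : ℝ≥0, 0 < c ∧ ∀ f ∈ ScreenedBesov.screenedSpace n 𝕜 s p q,
      (c : ℝ≥0∞)⁻¹ * ScreenedBesov.screenedSeminorm s p q f ≤
          ScreenedBesov.sumSeminorm (ScreenedBesov.besovSpace n 𝕜 s p q)
            (ScreenedBesov.sobolevSpace n 𝕜 p) (ScreenedBesov.besovNorm s p q)
            (ScreenedBesov.sobolevSeminorm p) f ∧
        ScreenedBesov.sumSeminorm (ScreenedBesov.besovSpace n 𝕜 s p q)
            (ScreenedBesov.sobolevSpace n 𝕜 p) (ScreenedBesov.besovNorm s p q)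
            (ScreenedBesov.sobolevSeminorm p) f ≤
          (c : ℝ≥0∞) * ScreenedBesov.screenedSeminorm s p q f) := by
  open ScreenedBesov in
  obtain ⟨C₁, hC₁⟩ := exists_besovNorm_highPart_add_le (s := s) n 𝕜 hp hq hs.1
  obtain ⟨C₂, hC₂⟩ := exists_screenedSeminorm_add_le hn 𝕜 hp hq hs
  set c : ℝ≥0 := C₁ + C₂ + 1
  have hc : 0 < c := by positivity
  have hc0 : (c : ℝ≥0∞) ≠ 0 := by exact_mod_cast hc.ne'
  have hupper (f : EuclideanSpace ℝ (Fin n) → 𝕜) (hf : LocallyIntegrable f volume) :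
      besovNorm s p q (highPart f) + sobolevSeminorm p (lowPart f) ≤
        c * screenedSeminorm s p q f :=
    (hC₁ f hf).trans (mul_le_mul_left (by exact_mod_cast le_add_right le_self_add) _)
  -- Stated for arbitrary summands, to serve both the pair `ℍ f`, `𝕃 f` and every competitor in the
  -- sum seminorm.
  have hlower (f g : EuclideanSpace ℝ (Fin n) → 𝕜) (hf : LocallyIntegrable f volume)
      (hg : LocallyIntegrable g volume) :
      (c : ℝ≥0∞)⁻¹ * screenedSeminorm s p q (f + g) ≤ besovNorm s p q f + sobolevSeminorm p g := by
    rw [ENNReal.inv_mul_le_iff hc0 ENNReal.coe_ne_top]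
    exact (hC₂ f g hf hg).trans
      (mul_le_mul_left (by exact_mod_cast le_add_right le_add_self) _)
  have hsplit (f : EuclideanSpace ℝ (Fin n) → 𝕜) (hf : LocallyIntegrable f volume) :
      highPart f + lowPart f = f := by
    rw [highPart_eq_sub hf, sub_add_cancel]
  have hmem (f : EuclideanSpace ℝ (Fin n) → 𝕜) (hf : f ∈ screenedSpace n 𝕜 s p q) :
      highPart f ∈ besovSpace n 𝕜 s p q ∧ lowPart f ∈ sobolevSpace n 𝕜 p := by
    have h := (hupper f hf.1).trans_lt (ENNReal.mul_lt_top ENNReal.coe_lt_top hf.2)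
    rw [ENNReal.add_lt_top] at h
    exact ⟨⟨locallyIntegrable_highPart hf.1, h.1⟩,
      mem_sobolevSpace (locallyIntegrable_lowPart hf.1) h.2⟩
  refine ⟨⟨c, hc, fun f hf => ⟨?_, hupper f hf⟩⟩, ?_, ⟨c, hc, fun f hf => ⟨?_, ?_⟩⟩⟩
  · simpa only [hsplit f hf] using
      hlower _ _ (locallyIntegrable_highPart hf) (locallyIntegrable_lowPart hf)
  · refine Subset.antisymm (fun f hf => ?_) ?_
    · exact mem_add.2 ⟨_, (hmem f hf).1, _, (hmem f hf).2, hsplit f hf.1⟩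
    · rintro _ ⟨f, hf, g, hg, rfl⟩
      refine ⟨hf.1.add hg.1, (hC₂ f g hf.1 hg.1).trans_lt ?_⟩
      exact ENNReal.mul_lt_top ENNReal.coe_lt_top
        (ENNReal.add_lt_top.2 ⟨hf.2, sobolevSeminorm_lt_top hg⟩)
  · refine le_iInf₂ fun f₀ h₀ => le_iInf₂ fun f₁ h₁ => le_iInf fun h => ?_
    rw [h]
    exact hlower f₀ f₁ h₀.1 h₁.1
  -- The pair `ℍ f`, `𝕃 f` is an admissible decomposition in the infimum.
  · refine le_trans ?_ (hupper f hf.1)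
    exact iInf₂_le_of_le _ (hmem f hf).1
      (iInf₂_le_of_le _ (hmem f hf).2 (iInf_le_of_le (hsplit f hf.1).symm le_rfl))
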